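/- Let $(R,\mathfrak m,k)$ be a commutative noetherian local ring and $d=\dim R$. For an $R$-module $N$ and an integer $i\ge 0$ let $$\zeta^i_N\colon \operatorname{Ext}^i_R(k,N)\xrightarrow{\ \cong\ }\operatorname{Ext}^i_R(k,\mathrm R\Gamma_{\mathfrak m}N)\longrightarrow \operatorname{Ext}^i_R(R,\mathrm R\Gamma_{\mathfrak m}N)\cong H^i_{\mathfrak m}(N)$$ be the composite in which the first map is the inverse of the isomorphism induced by the natural morphism $\mathrm R\Gamma_{\mathfrak m}N\to N$ and the middle map is induced by the surjection $R\to k$. Let $F$ be a minimal free resolution of $k$, let $\Omega=\operatorname{Coker}(F_{d+1}\to F_d)$, and let $\varepsilon\in\operatorname{Ext}^d_R(k,\Omega)$ be the class of the morphism $k\simeq F\to F_{\geqslant d}\simeq\Sigma^d\Omega$ in the derived category of $R$. (1) The following are equivalent: $\zeta^d_\Omega(\varepsilon)=0$; $\zeta^d_\Omega=0$; $\zeta^d_N=0$ for every $R$-module $N$. (2) Let $D$ be a dualizing complex for $R$, that is, a bounded complex of injective $R$-modules with finitely generated cohomology such that the homothety map $R\to\operatorname{Hom}_R(D,D)$ is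 a quasi-isomorphism. Suppose that $D$ is normalized so that $D^i=0$ for $i\notin[0,d]$ and $H^0(D)\ne 0$, and put $\omega_R=H^0(D)$. Then $\zeta^d_\Omega\neq 0$ if and only if $\zeta^d_{\omega_R}\neq 0$. -/

import Mathlib

open CategoryTheory CategoryTheory.Limits CategoryTheory.Abelian

universe u

noncomputable section

namespace LocalCoh

section Torsion

variable {R : Type u} [CommRing R] (I : Ideal R)

/-- The `I`-power torsion submodule `Γ_I M = {x ∈ M | I ^ n x = 0 for some n ≥ 0}`. -/
def powerTorsion (M : Type u) [AddCommGroup M] [Module R M] : Submodule R M where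
  carrier := {x | ∃ n : ℕ, ∀ a ∈ I ^ n, a • x = 0}
  zero_mem' := ⟨0, fun a _ => smul_zero a⟩
  add_mem' := by
    rintro x y ⟨m, hm⟩ ⟨n, hn⟩
    refine ⟨max m n, fun a ha => ?_⟩
    rw [smul_add, hm a (Ideal.pow_le_pow_right (le_max_left m n) ha),
      hn a (Ideal.pow_le_pow_right (le_max_right m n) ha), add_zero]
  smul_mem' := by
    rintro r x ⟨n, hn⟩
    exact ⟨n, fun a ha => by rw [smul_comm, hn a ha, smul_zero]⟩

lemma map_mem_powerTorsion {M N : ModuleCat.{u} R} (f : M ⟶ N) {x : M}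
    (hx : x ∈ powerTorsion I M) : f.hom x ∈ powerTorsion I N := by
  obtain ⟨n, hn⟩ := hx
  exact ⟨n, fun a ha => by rw [← map_smul, hn a ha, map_zero]⟩

/-- The `I`-power torsion functor `Γ_I`. -/
def torsionFunctor : ModuleCat.{u} R ⥤ ModuleCat.{u} R where
  obj M := ModuleCat.of R (powerTorsion I M)
  map f := ModuleCat.ofHom
    (f.hom.restrict (p := powerTorsion I _) (q := powerTorsion I _)
      fun _ hx => map_mem_powerTorsion I f hx)

instance : (torsionFunctor I).Additive where

/-- The inclusion `Γ_I M ⟶ M`. -/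
def torsionIncl (M : ModuleCat.{u} R) : (torsionFunctor I).obj M ⟶ M :=
  ModuleCat.ofHom (powerTorsion I M).subtype

instance (M : ModuleCat.{u} R) : Mono (torsionIncl I M) :=
  (ModuleCat.mono_iff_injective _).2 Subtype.val_injective

lemma torsionIncl_naturality {M N : ModuleCat.{u} R} (f : M ⟶ N) :
    (torsionFunctor I).map f ≫ torsionIncl I N = torsionIncl I M ≫ f := rfl

/-- The local cohomology module `H^i_I(N) = H^i(RΓ_I N)`. -/
abbrev localCoh (i : ℕ) (N : ModuleCat.{u} R) : ModuleCat.{u} R :=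
  ((torsionFunctor I).rightDerived i).obj N

end Torsion

section Zeta

variable (R : Type u) [CommRing R] [IsLocalRing R]

/-- The residue field `k` of `R`, as an `R`-module. -/
abbrev resField : ModuleCat.{u} R := ModuleCat.of R (IsLocalRing.ResidueField R)

/-- The surjection `R ⟶ k`. -/
def toResField : ModuleCat.of R R ⟶ resField R :=
  ModuleCat.ofHom (Algebra.linearMap R (IsLocalRing.ResidueField R))

/-- The functor `Γ_𝔪`. -/
abbrev mTorsion : ModuleCat.{u} R ⥤ ModuleCat.{u} R :=
  torsionFunctor (IsLocalRing.maximalIdeal R)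

variable {R}

/-- Every map `k ⟶ M` takes values in `Γ_𝔪 M`; this is the inverse of the bijection
`Hom(k, Γ_𝔪 M) ≅ Hom(k, M)`. -/
def liftTorsion {M : ModuleCat.{u} R} (f : resField R ⟶ M) :
    resField R ⟶ (mTorsion R).obj M :=
  ModuleCat.ofHom (f.hom.codRestrict (powerTorsion (IsLocalRing.maximalIdeal R) M) fun x =>
    ⟨1, fun a ha => by
      rw [pow_one] at ha
      have h : a • x = 0 := by
        rw [Algebra.smul_def]
        have : algebraMap R (IsLocalRing.ResidueField R) a = 0 :=
          (IsLocalRing.residue_eq_zero_iff a).2 ha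
        rw [this, zero_mul]
      rw [← map_smul, h, map_zero]⟩)

lemma liftTorsion_incl {M : ModuleCat.{u} R} (f : resField R ⟶ M) :
    liftTorsion f ≫ torsionIncl (IsLocalRing.maximalIdeal R) M = f := rfl

lemma liftTorsion_map {M N : ModuleCat.{u} R} (f : resField R ⟶ M) (g : M ⟶ N) :
    liftTorsion f ≫ (mTorsion R).map g = liftTorsion (f ≫ g) := rfl

section

variable (N : ModuleCat.{u} R) (i : ℕ)

/-- The complex `Γ_𝔪 J` where `J` is an injective resolution of `N`; it represents `RΓ_𝔪 N`. -/
abbrev derivedTorsion : CochainComplex (ModuleCat.{u} R) ℕ :=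
  ((mTorsion R).mapHomologicalComplex _).obj (injectiveResolution N).cocomplex

/-- The cocycles of degree `i` in `Hom_R(k, J)`, with `J` the injective resolution of `N`. -/
def homCocycles : Submodule R (resField R ⟶ (injectiveResolution N).cocomplex.X i) where
  carrier := {f | f ≫ (injectiveResolution N).cocomplex.d i (i + 1) = 0}
  zero_mem' := zero_comp
  add_mem' := by
    intro f g hf hg
    rw [Set.mem_ofPred_eq] at *
    rw [Preadditive.add_comp, hf, hg, add_zero]
  smul_mem' := by
    intro r f hf
    rw [Set.mem_ofPred_eq] at *
    rw [Linear.smul_comp, hf, smul_zero]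

/-- The class in `Ext^i_R(k, N)` of a cocycle of degree `i` of `Hom_R(k, J)`. -/
def toExt : homCocycles N i →ₗ[R] Ext (resField R) N i where
  toFun f := (injectiveResolution N).extMk f.1 (i + 1) rfl f.2
  map_add' f g := ((injectiveResolution N).add_extMk f.1 g.1 (i + 1) rfl f.2 g.2).symm
  map_smul' r f := by
    have h := (injectiveResolution N).mk₀_comp_extMk f.1 (i + 1) rfl f.2
      (r • 𝟙 (resField R))
    have h2 : (Ext.mk₀ (r • 𝟙 (resField R))) = r • Ext.mk₀ (𝟙 (resField R)) := by
      exact Ext.mk₀_smul _ _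
    rw [h2, Ext.smul_comp, Ext.mk₀_id_comp] at h
    simp only [Linear.smul_comp, Category.id_comp] at h
    exact h.symm

lemma toExt_surjective : Function.Surjective (toExt N i) := by
  intro x
  obtain ⟨f, hf, h⟩ := (injectiveResolution N).extMk_surjective x (i + 1) rfl
  exact ⟨⟨f, hf⟩, h⟩

/-- A map `f : k ⟶ J^i` is viewed as a map `k ⟶ Γ_𝔪 J^i`, then restricted along `R ⟶ k`. -/
def toTorsion (f : resField R ⟶ (injectiveResolution N).cocomplex.X i) :
    ModuleCat.of R R ⟶ (derivedTorsion N).X i :=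
  toResField R ≫ liftTorsion f

lemma toTorsion_add (f g : resField R ⟶ (injectiveResolution N).cocomplex.X i) :
    toTorsion N i (f + g) = toTorsion N i f + toTorsion N i g := rfl

lemma toTorsion_smul (r : R) (f : resField R ⟶ (injectiveResolution N).cocomplex.X i) :
    toTorsion N i (r • f) = r • toTorsion N i f := rfl

lemma toTorsion_zero : toTorsion N i 0 = 0 := rfl

lemma toTorsion_d (f : resField R ⟶ (injectiveResolution N).cocomplex.X i) (j : ℕ) :
    toTorsion N i f ≫ (derivedTorsion N).d i j =
      toTorsion N j (f ≫ (injectiveResolution N).cocomplex.d i j) := rfl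

/-- For a cocycle `f : k ⟶ J^i`, the resulting map from `R` to the `i`-cocycles of `Γ_𝔪 J`. -/
def toCycles (f : homCocycles N i) : ModuleCat.of R R ⟶ (derivedTorsion N).cycles i :=
  (derivedTorsion N).liftCycles (toTorsion N i f.1) (i + 1) (by simp) (by
    have hf : f.1 ≫ (injectiveResolution N).cocomplex.d i (i + 1) = 0 := f.2
    rw [toTorsion_d, hf, toTorsion_zero])

lemma toCycles_iCycles (f : homCocycles N i) :
    toCycles N i f ≫ (derivedTorsion N).iCycles i = toTorsion N i f.1 :=
  HomologicalComplex.liftCycles_i _ _ _ _ _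

/-- The identification `H^i(Γ_𝔪 J) ≅ H^i_𝔪(N)`. -/
def homologyIso :
    (derivedTorsion N).homology i ≅ localCoh (IsLocalRing.maximalIdeal R) i N :=
  ((injectiveResolution N).isoRightDerivedObj (mTorsion R) i).symm

/-- The class in `H^i_𝔪(N)` of the image of `1` under `R ⟶ k ⟶ Γ_𝔪 J^i`, for a cocycle
`f : k ⟶ J^i` of `Hom_R(k, J) = Hom_R(k, Γ_𝔪 J)`. -/
def toLocalCoh : homCocycles N i →ₗ[R] localCoh (IsLocalRing.maximalIdeal R) i N where
  toFun f := (toCycles N i f ≫ (derivedTorsion N).homologyπ i ≫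
    (homologyIso N i).hom).hom (1 : R)
  map_add' f g := by
    have h : toCycles N i (f + g) = toCycles N i f + toCycles N i g := by
      rw [← cancel_mono ((derivedTorsion N).iCycles i), Preadditive.add_comp,
        toCycles_iCycles, toCycles_iCycles, toCycles_iCycles, ← toTorsion_add]
      rfl
    rw [h, Preadditive.add_comp]
    rfl
  map_smul' r f := by
    have h : toCycles N i (r • f) = r • toCycles N i f := by
      rw [← cancel_mono ((derivedTorsion N).iCycles i), Linear.smul_comp,
        toCycles_iCycles, toCycles_iCycles, ← toTorsion_smul]
      rfl
    rw [h, Linear.smul_comp]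
    rfl

lemma ker_toExt_le : LinearMap.ker (toExt N i) ≤ LinearMap.ker (toLocalCoh N i) := by
  rintro ⟨f, hf⟩ h
  have h : (injectiveResolution N).extMk f (i + 1) rfl hf = 0 := h
  suffices H : toCycles N i ⟨f, hf⟩ ≫ (derivedTorsion N).homologyπ i = 0 by
    change (toCycles N i ⟨f, hf⟩ ≫ (derivedTorsion N).homologyπ i ≫
      (homologyIso N i).hom).hom (1 : R) = 0
    rw [reassoc_of% H, zero_comp]
    rfl
  cases i with
  | zero =>
    have hf0 : f = 0 := by
      have h' := congrArg (injectiveResolution N).extEquivCohomologyClass h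
      erw [InjectiveResolution.extEquivCohomologyClass_extMk,
        InjectiveResolution.extEquivCohomologyClass_zero] at h'
      rw [
        CochainComplex.HomComplex.CohomologyClass.mk_eq_zero_iff,
        CochainComplex.HomComplex.Cocycle.fromSingleMk_mem_coboundaries_iff _ _ _ _ _ (-1)
          (by simp)] at h'
      obtain ⟨g, hg⟩ := h'
      have hg0 : g = 0 :=
        (CochainComplex.isZero_of_isStrictlyGE _ 0 (-1) (by lia)).eq_of_tgt _ _
      rw [hg0, zero_comp] at hg
      rw [← cancel_mono ((injectiveResolution N).cochainComplexXIso _ 0 rfl).inv, ← hg, zero_comp]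
    subst hf0
    have : toCycles N 0 ⟨0, hf⟩ = 0 := by
      rw [← cancel_mono ((derivedTorsion N).iCycles 0), toCycles_iCycles, zero_comp]
      exact toTorsion_zero N 0
    rw [this, zero_comp]
  | succ p =>
    obtain ⟨g, hg⟩ := ((injectiveResolution N).extMk_eq_zero_iff f (p + 1 + 1) rfl hf p rfl).1 h
    have : toCycles N (p + 1) ⟨f, hf⟩ =
        toTorsion N p g ≫ (derivedTorsion N).toCycles p (p + 1) := by
      rw [← cancel_mono ((derivedTorsion N).iCycles (p + 1)), toCycles_iCycles, Category.assoc,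
        HomologicalComplex.toCycles_i, toTorsion_d, hg]
    rw [this, Category.assoc, HomologicalComplex.toCycles_comp_homologyπ, comp_zero]

/-- The map `ζ^i_N`, the composition
`Ext^i_R(k, N) ≅ Ext^i_R(k, RΓ_𝔪 N) ⟶ Ext^i_R(R, RΓ_𝔪 N) ≅ H^i_𝔪(N)`.
With `J` an injective resolution of `N`, it is the map induced in cohomology by
`Hom_R(k, J) = Hom_R(k, Γ_𝔪 J) ⟶ Hom_R(R, Γ_𝔪 J) = Γ_𝔪 J`. -/
def zeta : Ext (resField R) N i →ₗ[R] localCoh (IsLocalRing.maximalIdeal R) i N :=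
  (LinearMap.ker (toExt N i)).liftQ (toLocalCoh N i) (ker_toExt_le N i) ∘ₗ
    ((toExt N i).quotKerEquivOfSurjective (toExt_surjective N i)).symm.toLinearMap

lemma zeta_toExt (f : homCocycles N i) : zeta N i (toExt N i f) = toLocalCoh N i f := by
  have h : ((toExt N i).quotKerEquivOfSurjective (toExt_surjective N i)).symm (toExt N i f) =
      Submodule.Quotient.mk f := by
    rw [LinearEquiv.symm_apply_eq]
    rfl
  simp only [zeta, LinearMap.comp_apply, LinearEquiv.coe_coe, h]
  rfl

end

section Minimal

/-- A projective resolution `F` of `k` is a minimal free resolution: the modules `F_n` are free of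
finite rank, and `d(F_{n+1}) ⊆ 𝔪 F_n`. -/
structure IsMinimalFree (F : ProjectiveResolution (resField R)) : Prop where
  free : ∀ n, Module.Free R (F.complex.X n)
  finite : ∀ n, Module.Finite R (F.complex.X n)
  minimal : ∀ n, LinearMap.range (F.complex.d (n + 1) n).hom ≤
    IsLocalRing.maximalIdeal R • (⊤ : Submodule R (F.complex.X n))

variable (F : ProjectiveResolution (resField R)) (d : ℕ)

/-- `Ω = Coker(F_{d+1} → F_d)`, the `d`-th syzygy module of `k` in the resolution `F`. -/
def syzygy : ModuleCat.{u} R := cokernel (F.complex.d (d + 1) d)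

/-- The class `ε ∈ Ext^d_R(k, Ω)` of the morphism `k ≃ F ⟶ F_{≥ d} ≃ Σ^d Ω`, which is given by the
canonical surjection `F_d ⟶ Ω` in degree `d`. -/
def canonicalClass : Ext (resField R) (syzygy F d) d :=
  F.extMk (Y := syzygy F d) (cokernel.π (F.complex.d (d + 1) d)) (d + 1) rfl
    (cokernel.condition (F.complex.d (d + 1) d))

end Minimal

end Zeta

section Dualizing

variable {R : Type u} [CommRing R]

/-- A dualizing complex: a bounded complex `D` of injective modules with finitely generated
cohomology such that the homothety map `R ⟶ Hom_R(D, D)` is a quasi-isomorphism, where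
`H^n(Hom_R(D, D))` is the group of homotopy classes of maps `D ⟶ Σ^n D`. Since `D` is a bounded
complex of injectives, `Hom_R(D, D)` is `RHom_R(D, D)`. -/
structure IsDualizingComplex (D : CochainComplex (ModuleCat.{u} R) ℤ) : Prop where
  bounded : ∃ a b : ℤ, ∀ n, n < a ∨ b < n → IsZero (D.X n)
  injective : ∀ n, Injective (D.X n)
  finite : ∀ n, Module.Finite R (D.homology n)
  homothety_bijective : Function.Bijective fun r : R =>
    (HomotopyCategory.quotient (ModuleCat.{u} R) (ComplexShape.up ℤ)).map (r • 𝟙 D)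
  homotopic_zero : ∀ n : ℤ, n ≠ 0 → ∀ f : D ⟶ (shiftFunctor _ n).obj D, Nonempty (Homotopy f 0)

/-- A dualizing complex over a ring of Krull dimension `d` is normalized when it is concentrated
in cohomological degrees `0, …, d` and its cohomology in degree `0` is not zero. -/
structure IsNormalizedDualizingComplex (d : ℕ) (D : CochainComplex (ModuleCat.{u} R) ℤ) : Prop
    extends IsDualizingComplex D where
  range : ∀ n : ℤ, n < 0 ∨ (d : ℤ) < n → IsZero (D.X n)
  homology_ne_zero : ¬ IsZero (D.homology 0)

/-- The canonical module `ω_R = H^0(D)` attached to a normalized dualizing complex `D`. -/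
abbrev canonicalModule (D : CochainComplex (ModuleCat.{u} R) ℤ) : ModuleCat.{u} R := D.homology 0

end Dualizing

end LocalCoh

end

noncomputable section

namespace LocalCoh

/-! ### Vanishing of `ζ` tested on the quotients `R/𝔪^(n+1)`, and universality of `ε`. -/

section ZetaVanishing

/-! Local cohomology is the colimit of the modules `Ext^i(R/𝔪^(n+1), N)`, and `ζ^i_N` is the map
from the term `n = 0`. Hence `ζ(α) = 0` exactly when the restriction of `α` along some `R/𝔪^(n+1) →
k` vanishes (`zeta_eq_zero_iff`).

Part (1): a cocycle `F_d → N` factors through `Ω`, so every class in `Ext^d(k, N)` is the image of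
`ε` under a map `Ω → N`. Such maps preserve the vanishing of `ζ`, so everything follows from `ζ(ε) =
0`.

Part (2) reduces to the claim that `ζ^d_ω = 0` forces `ζ^d_N = 0` for every finitely generated `N`,
in particular for `Ω`; this is `zeta_eq_zero_of_canonicalModule`. Apply `RHom(-, D)` to the
restrictions of `α ∈ Ext^d(k, N)`. They become compatible maps from `Hom(N, D)` to `Hom(R/𝔪^(n+1),
D)`, shifted by `d`, and have a common composite to the shift of `Γ_𝔪 D`. Three facts finish the
proof.

(a) `Γ_𝔪 D` has at most one nonzero cohomology module, which is injective
(`exists_torsionComplex_homology`). A derived map into it is therefore zero as soon as it is zero on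
that cohomology (`eq_zero_of_homologyFunctor_map_eq_zero`). The only degree to examine is 0, where
the classes of `Hom(N, D)` are maps `g : N → ω`; there the composite is controlled by `ζ_ω(g_* α) =
0`.

(b) `Hom(N, D)` is bounded with finitely generated cohomology, so a map which vanishes in the union
`Γ_𝔪 D` vanishes at a finite stage (`exists_comp_dualQuotPowMap_eq_zero`).

(c) Biduality `N ≃ Hom(Hom(N, D), D)` makes dualization faithful on maps into `N`
(`quasiIso_evalDual_sg`, `eq_zero_of_dualHom_eq_zero`), so the corresponding restriction of `α` is
zero. -/

lemma exists_toCycles_eq_of_homologyπ_eq_zero {R : Type u} [Ring R] {ι : Type*}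
    {c : ComplexShape ι} (K : HomologicalComplex (ModuleCat.{u} R) c) (i j : ι) (hij : c.prev j = i)
    (x : K.cycles j) (hx : (K.homologyπ j).hom x = 0) :
    ∃ y : K.X i, (K.toCycles i j).hom y = x := by
  let S := ShortComplex.mk (K.toCycles i j) (K.homologyπ j) (by simp)
  have hS : S.Exact := ShortComplex.exact_of_g_is_cokernel S (K.homologyIsCokernel i j hij)
  rw [ShortComplex.moduleCat_exact_iff] at hS
  exact hS x hx

/-- A cocycle of degree 0 has no coboundaries to be compared with: the resolution, seen as a complex
indexed by `ℤ`, is zero in degree -1. -/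
lemma extMk_zero_eq_zero {R : Type u} [CommRing R] {X Y : ModuleCat.{u} R} (J : InjectiveResolution Y)
    (f : X ⟶ J.cocomplex.X 0) (hf : f ≫ J.cocomplex.d 0 1 = 0)
    (h : J.extMk f 1 rfl hf = 0) : f = 0 := by
  have h' := congrArg J.extEquivCohomologyClass h
  erw [InjectiveResolution.extEquivCohomologyClass_extMk,
    InjectiveResolution.extEquivCohomologyClass_zero] at h'
  rw [CochainComplex.HomComplex.CohomologyClass.mk_eq_zero_iff,
    CochainComplex.HomComplex.Cocycle.fromSingleMk_mem_coboundaries_iff _ _ _ _ _ (-1)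
      (by simp)] at h'
  obtain ⟨g, hg⟩ := h'
  have hg0 : g = 0 :=
    (CochainComplex.isZero_of_isStrictlyGE _ 0 (-1) (by lia)).eq_of_tgt _ _
  rw [hg0, zero_comp] at hg
  rw [← cancel_mono (J.cochainComplexXIso _ 0 rfl).inv, ← hg, zero_comp]

variable {R : Type u} [CommRing R] [IsLocalRing R]

variable (R) in
/-- The quotient `R ⧸ 𝔪 ^ (n + 1)`, as an `R`-module. -/
abbrev quotPow (n : ℕ) : ModuleCat.{u} R :=
  ModuleCat.of R (R ⧸ (IsLocalRing.maximalIdeal R ^ (n + 1)))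

variable (R) in
/-- The surjection `R ⧸ 𝔪 ^ (n + 1) ⟶ k`. -/
def quotPowToResField (n : ℕ) : quotPow R n ⟶ resField R :=
  ModuleCat.ofHom (Submodule.liftQ _ (Algebra.linearMap R (IsLocalRing.ResidueField R)) (by
    intro x hx
    exact (IsLocalRing.residue_eq_zero_iff x).2 (Ideal.pow_le_self n.succ_ne_zero hx)))

variable (R) in
/-- The transition map `R ⧸ 𝔪 ^ (m + 1) ⟶ R ⧸ 𝔪 ^ (n + 1)` for `n ≤ m`. -/
def quotPowMap {n m : ℕ} (h : n ≤ m) : quotPow R m ⟶ quotPow R n :=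
  ModuleCat.ofHom (Submodule.factor (Ideal.pow_le_pow_right (Nat.add_le_add_right h 1)))

variable (R) in
/-- The surjection `R ⟶ R ⧸ 𝔪 ^ (n + 1)`. -/
def toQuotPow (n : ℕ) : ModuleCat.of R R ⟶ quotPow R n :=
  ModuleCat.ofHom (Submodule.mkQ _)

instance (n : ℕ) : Epi (toQuotPow R n) :=
  (ModuleCat.epi_iff_surjective _).2 (Submodule.mkQ_surjective _)

lemma toQuotPow_comp_quotPowToResField (n : ℕ) :
    toQuotPow R n ≫ quotPowToResField R n = toResField R := by
  ext; rfl

lemma toQuotPow_comp_quotPowMap {n m : ℕ} (h : n ≤ m) :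
    toQuotPow R m ≫ quotPowMap R h = toQuotPow R n := by
  ext; rfl

lemma quotPowMap_comp_quotPowToResField {n m : ℕ} (h : n ≤ m) :
    quotPowMap R h ≫ quotPowToResField R n = quotPowToResField R m := by
  rw [← cancel_epi (toQuotPow R m), ← Category.assoc, toQuotPow_comp_quotPowMap,
    toQuotPow_comp_quotPowToResField, toQuotPow_comp_quotPowToResField]

lemma toResField_surjective : Function.Surjective (toResField R).hom :=
  IsLocalRing.residue_surjective

instance : Epi (toResField R) :=
  (ModuleCat.epi_iff_surjective _).2 toResField_surjective

instance (n : ℕ) : Epi (quotPowToResField R n) :=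
  have : Epi (toQuotPow R n ≫ quotPowToResField R n) := by
    rw [toQuotPow_comp_quotPowToResField]; infer_instance
  epi_of_epi (toQuotPow R n) _

lemma exists_toQuotPow_comp_eq {M : ModuleCat.{u} R} (x : M) (n : ℕ)
    (hx : ∀ a ∈ IsLocalRing.maximalIdeal R ^ (n + 1), a • x = 0) :
    ∃ g : quotPow R n ⟶ M, (toQuotPow R n ≫ g).hom (1 : R) = x := by
  refine ⟨ModuleCat.ofHom (Submodule.liftQ _ (LinearMap.toSpanSingleton R M x) ?_), ?_⟩
  · intro a ha
    rw [LinearMap.mem_ker, LinearMap.toSpanSingleton_apply]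
    exact hx a ha
  · exact one_smul R x

/-- For a cocycle `f : k ⟶ J^i` with `i > 0`, the class `ζ(f)` vanishes when `f(1) = d y` with `y`
in `Γ_𝔪 J^(i-1)`. Such a `y` is killed by some `𝔪^(n+1)`, so it is a map `R/𝔪^(n+1) ⟶ J^(i-1)`, and
its coboundary is the restriction of `f`. In degree 0 both conditions say `f = 0`. -/
lemma zeta_eq_zero_iff (N : ModuleCat.{u} R) (i : ℕ) (α : Ext (resField R) N i) :
    zeta N i α = 0 ↔
      ∃ n, (Ext.mk₀ (quotPowToResField R n)).comp α (zero_add i) = 0 := by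
  obtain ⟨⟨f, hf⟩, rfl⟩ := toExt_surjective N i α
  have hf' : f ≫ (injectiveResolution N).cocomplex.d i (i + 1) = 0 := hf
  have key (n : ℕ) : (Ext.mk₀ (quotPowToResField R n)).comp (toExt N i ⟨f, hf⟩) (zero_add i) =
      (injectiveResolution N).extMk (quotPowToResField R n ≫ f) (i + 1) rfl
        (by rw [Category.assoc, hf', comp_zero]) :=
    (injectiveResolution N).mk₀_comp_extMk f (i + 1) rfl hf' _
  simp only [key]
  have hz : zeta N i (toExt N i ⟨f, hf⟩) = 0 ↔
      (toCycles N i ⟨f, hf⟩ ≫ (derivedTorsion N).homologyπ i).hom (1 : R) = 0 := by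
    rw [zeta_toExt]
    change ((homologyIso N i).hom).hom
      ((toCycles N i ⟨f, hf⟩ ≫ (derivedTorsion N).homologyπ i).hom (1 : R)) = 0 ↔ _
    exact map_eq_zero_iff _ ((ModuleCat.mono_iff_injective (homologyIso N i).hom).1 inferInstance)
  rw [hz]
  constructor
  · intro h
    cases i with
    | zero =>
      -- By convention the predecessor of 0 in this shape is 0 itself, with `d 0 0 = 0`; a boundary
      -- in degree 0 is thus zero.
      obtain ⟨y, hy⟩ := exists_toCycles_eq_of_homologyπ_eq_zero (derivedTorsion N) 0 0 (by simp)
        _ h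
      refine ⟨0, ?_⟩
      have h1 : (toTorsion N 0 f).hom (1 : R) = 0 := by
        rw [← toCycles_iCycles N 0 ⟨f, hf⟩]
        change ((derivedTorsion N).iCycles 0).hom _ = 0
        rw [← hy]
        change (((derivedTorsion N).toCycles 0 0) ≫ (derivedTorsion N).iCycles 0).hom y = 0
        rw [HomologicalComplex.toCycles_i, HomologicalComplex.shape _ _ _ (by simp)]
        rfl
      have h2 : toResField R ≫ f = 0 := by
        ext
        exact congrArg Subtype.val h1
      have hf0 : f = 0 := by rw [← cancel_epi (toResField R), h2, comp_zero]
      subst hf0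
      simp
    | succ p =>
      obtain ⟨y, hy⟩ := exists_toCycles_eq_of_homologyπ_eq_zero (derivedTorsion N) p (p + 1)
        (by simp) _ h
      have h1 : (toTorsion N (p + 1) f).hom (1 : R) = ((derivedTorsion N).d p (p + 1)).hom y := by
        rw [← toCycles_iCycles N (p + 1) ⟨f, hf⟩]
        change ((derivedTorsion N).iCycles (p + 1)).hom _ = _
        rw [← (derivedTorsion N).toCycles_i p (p + 1)]
        exact congrArg ((derivedTorsion N).iCycles (p + 1)).hom hy.symm
      obtain ⟨n, hn⟩ := y.2
      obtain ⟨g, hg⟩ := exists_toQuotPow_comp_eq (M := (injectiveResolution N).cocomplex.X p)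
        y.1 n (fun a ha => hn a (Ideal.pow_le_pow_right n.le_succ ha))
      refine ⟨n, ((injectiveResolution N).extMk_eq_zero_iff _ (p + 1 + 1) rfl _ p rfl).2
        ⟨g, ?_⟩⟩
      rw [← cancel_epi (toQuotPow R n), ← Category.assoc, ← Category.assoc,
        toQuotPow_comp_quotPowToResField]
      ext
      change ((injectiveResolution N).cocomplex.d p (p + 1)).hom ((toQuotPow R n ≫ g).hom (1 : R)) =
        (toResField R ≫ f).hom (1 : R)
      rw [hg]
      exact (congrArg Subtype.val h1).symm
  · rintro ⟨n, hn⟩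
    cases i with
    | zero =>
      have h0 := extMk_zero_eq_zero _ _ _ hn
      have hf0 : f = 0 := by rw [← cancel_epi (quotPowToResField R n), h0, comp_zero]
      subst hf0
      have : toCycles N 0 ⟨0, hf⟩ = 0 := by
        rw [← cancel_mono ((derivedTorsion N).iCycles 0), toCycles_iCycles, zero_comp]
        exact toTorsion_zero N 0
      rw [this, zero_comp]
      rfl
    | succ p =>
      obtain ⟨g, hg⟩ := ((injectiveResolution N).extMk_eq_zero_iff _ (p + 1 + 1) rfl _ p rfl).1 hn
      let y : (derivedTorsion N).X p :=
        ⟨(toQuotPow R n ≫ g).hom (1 : R), n + 1, fun a ha => by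
          change a • g.hom _ = 0
          have : a • (toQuotPow R n).hom (1 : R) = 0 := by
            change Submodule.Quotient.mk (a • (1 : R)) = 0
            rw [Submodule.Quotient.mk_eq_zero]
            simpa using ha
          exact (map_smul g.hom a _).symm.trans ((congrArg g.hom this).trans (map_zero g.hom))⟩
      have : (toCycles N (p + 1) ⟨f, hf⟩).hom (1 : R) =
          ((derivedTorsion N).toCycles p (p + 1)).hom y := by
        apply (ModuleCat.mono_iff_injective ((derivedTorsion N).iCycles (p + 1))).1 inferInstance
        change (toCycles N (p + 1) ⟨f, hf⟩ ≫ (derivedTorsion N).iCycles (p + 1)).hom (1 : R) =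
          ((derivedTorsion N).toCycles p (p + 1) ≫ (derivedTorsion N).iCycles (p + 1)).hom y
        rw [toCycles_iCycles, HomologicalComplex.toCycles_i]
        apply Subtype.ext
        change (toResField R ≫ f).hom (1 : R) =
          ((toQuotPow R n ≫ g) ≫ (injectiveResolution N).cocomplex.d p (p + 1)).hom (1 : R)
        rw [Category.assoc, hg, ← Category.assoc, toQuotPow_comp_quotPowToResField]
      change ((derivedTorsion N).homologyπ (p + 1)).hom
        ((toCycles N (p + 1) ⟨f, hf⟩).hom (1 : R)) = 0
      rw [this]
      change ((derivedTorsion N).toCycles p (p + 1) ≫ (derivedTorsion N).homologyπ (p + 1)).hom y = 0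
      rw [HomologicalComplex.toCycles_comp_homologyπ]
      rfl

/-- Only preservation of vanishing is needed, and in terms of restrictions it is associativity of
composition; the injective resolutions of `M` and `N` need not be compared. -/
lemma zeta_comp_mk₀_eq_zero {M N : ModuleCat.{u} R} {i : ℕ} (α : Ext (resField R) M i)
    (g : M ⟶ N) (h : zeta M i α = 0) : zeta N i (α.comp (Ext.mk₀ g) (add_zero i)) = 0 := by
  rw [zeta_eq_zero_iff] at h ⊢
  obtain ⟨n, hn⟩ := h
  refine ⟨n, ?_⟩
  rw [← Ext.comp_assoc_of_third_deg_zero, hn, Ext.zero_comp]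

/-- A cocycle `F_d ⟶ N` kills the image of `F_(d+1)`, hence factors through the projection `F_d ⟶ Ω`
that represents `ε`. -/
lemma exists_canonicalClass_comp_eq (F : ProjectiveResolution (resField R)) (d : ℕ)
    {N : ModuleCat.{u} R} (α : Ext (resField R) N d) :
    ∃ g : syzygy F d ⟶ N, (canonicalClass F d).comp (Ext.mk₀ g) (add_zero d) = α := by
  obtain ⟨f, hf, rfl⟩ := F.extMk_surjective α (d + 1) rfl
  refine ⟨cokernel.desc _ f hf, ?_⟩
  refine (F.extMk_comp_mk₀ (Y := syzygy F d) _ (d + 1) rfl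
    (cokernel.condition (F.complex.d (d + 1) d)) _).trans ?_
  congr 1
  exact cokernel.π_desc _ _ _

lemma zeta_eq_zero_of_canonicalClass (F : ProjectiveResolution (resField R)) (d : ℕ)
    (h : zeta (syzygy F d) d (canonicalClass F d) = 0) (N : ModuleCat.{u} R) :
    zeta N d = 0 := by
  ext α
  obtain ⟨g, rfl⟩ := exists_canonicalClass_comp_eq F d α
  exact zeta_comp_mk₀_eq_zero _ g h

end ZetaVanishing

/-! ### Cycles, boundaries and cohomology classes of complexes of modules, in terms of elements. -/

section Elementwise

variable {R : Type u} [Ring R] {K L : CochainComplex (ModuleCat.{u} R) ℤ}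

lemma iCycles_injective (K : CochainComplex (ModuleCat.{u} R) ℤ) (n : ℤ) :
    Function.Injective (K.iCycles n).hom :=
  (ModuleCat.mono_iff_injective (K.iCycles n)).1 inferInstance

lemma homologyπ_surjective (K : CochainComplex (ModuleCat.{u} R) ℤ) (n : ℤ) :
    Function.Surjective (K.homologyπ n).hom :=
  (ModuleCat.epi_iff_surjective (K.homologyπ n)).1 inferInstance

lemma d_iCycles (n m : ℤ) (c : K.cycles n) : (K.d n m).hom ((K.iCycles n).hom c) = 0 := by
  have h := K.iCycles_d n m
  exact congrArg (fun f => f.hom c) h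

lemma exists_cycles (n m : ℤ) (hm : n + 1 = m) (x : K.X n) (hx : (K.d n m).hom x = 0) :
    ∃ c : K.cycles n, (K.iCycles n).hom c = x := by
  let S := ShortComplex.mk (K.iCycles n) (K.d n m) (by simp)
  have hS : S.Exact := ShortComplex.exact_of_f_is_kernel S (K.cyclesIsKernel n m (by simp [hm]))
  rw [ShortComplex.moduleCat_exact_iff] at hS
  exact hS x hx

lemma homologyπ_eq_zero_iff (m n : ℤ) (hm : m + 1 = n) (c : K.cycles n) :
    (K.homologyπ n).hom c = 0 ↔ ∃ y : K.X m, (K.d m n).hom y = (K.iCycles n).hom c := by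
  constructor
  · intro h
    obtain ⟨y, rfl⟩ := exists_toCycles_eq_of_homologyπ_eq_zero K m n
      (by simp; lia) c h
    exact ⟨y, congrArg (fun f => f.hom y) (K.toCycles_i m n).symm⟩
  · rintro ⟨y, hy⟩
    have : (K.toCycles m n).hom y = c := by
      apply iCycles_injective
      rw [← hy]
      exact congrArg (fun f => f.hom y) (K.toCycles_i m n)
    rw [← this]
    exact congrArg (fun f => f.hom y) (K.toCycles_comp_homologyπ m n)

lemma exactAt_iff_forall (l n m : ℤ) (hl : l + 1 = n) (hm : n + 1 = m) :
    K.ExactAt n ↔ ∀ x : K.X n, (K.d n m).hom x = 0 → ∃ y : K.X l, (K.d l n).hom y = x := by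
  rw [K.exactAt_iff' l n m (by simp; lia) (by simp [hm]), ShortComplex.moduleCat_exact_iff]
  rfl

lemma homologyMap_homologyπ (f : K ⟶ L) (n : ℤ) (c : K.cycles n) :
    (HomologicalComplex.homologyMap f n).hom ((K.homologyπ n).hom c) =
      (L.homologyπ n).hom ((HomologicalComplex.cyclesMap f n).hom c) :=
  congrArg (fun f => f.hom c) (HomologicalComplex.homologyπ_naturality f n)

lemma iCycles_cyclesMap (f : K ⟶ L) (n : ℤ) (c : K.cycles n) :
    (L.iCycles n).hom ((HomologicalComplex.cyclesMap f n).hom c) =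
      (f.f n).hom ((K.iCycles n).hom c) :=
  congrArg (fun f => f.hom c) (HomologicalComplex.cyclesMap_i f n)

lemma isIso_homologyMap_of_forall (f : K ⟶ L) (l n m : ℤ) (hl : l + 1 = n) (hm : n + 1 = m)
    (hinj : ∀ x : K.X n, (K.d n m).hom x = 0 → (∃ y : L.X l, (L.d l n).hom y = (f.f n).hom x) →
      ∃ y : K.X l, (K.d l n).hom y = x)
    (hsurj : ∀ z : L.X n, (L.d n m).hom z = 0 → ∃ x : K.X n, (K.d n m).hom x = 0 ∧
      ∃ y : L.X l, (L.d l n).hom y = (f.f n).hom x - z) :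
    IsIso (HomologicalComplex.homologyMap f n) := by
  rw [ConcreteCategory.isIso_iff_bijective]
  constructor
  · refine (injective_iff_map_eq_zero (HomologicalComplex.homologyMap f n).hom).2 fun x hx => ?_
    obtain ⟨c, rfl⟩ := homologyπ_surjective K n x
    rw [homologyMap_homologyπ, homologyπ_eq_zero_iff l n hl, iCycles_cyclesMap] at hx
    exact (homologyπ_eq_zero_iff l n hl _).2 (hinj _ (d_iCycles n m c) hx)
  · intro z
    obtain ⟨c, rfl⟩ := homologyπ_surjective L n z
    obtain ⟨x, hx, hy⟩ := hsurj _ (d_iCycles n m c)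
    obtain ⟨c', rfl⟩ := exists_cycles n m hm x hx
    refine ⟨(K.homologyπ n).hom c', ?_⟩
    change (HomologicalComplex.homologyMap f n).hom ((K.homologyπ n).hom c') = _
    rw [homologyMap_homologyπ, ← sub_eq_zero, ← map_sub]
    refine (homologyπ_eq_zero_iff l n hl _).2 ?_
    rw [map_sub, iCycles_cyclesMap]
    exact hy

end Elementwise

/-! ### The contravariant functor `Hom_R(-, D)` on complexes and the biduality map. -/

section Dual

open CochainComplex CochainComplex.HomComplex

variable {R : Type u} [CommRing R] (D : CochainComplex (ModuleCat.{u} R) ℤ)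

/-- The complex of `R`-modules `Hom_R(X, D)`. -/
def dual (X : CochainComplex (ModuleCat.{u} R) ℤ) : CochainComplex (ModuleCat.{u} R) ℤ where
  X n := ModuleCat.of R (Cochain X D n)
  d i j := ModuleCat.ofHom (δ_hom R X D i j)
  shape i j hij := by
    ext z : 2
    exact δ_shape i j hij z
  d_comp_d' i j k _ _ := by
    ext z : 2
    exact δ_δ i j k z

variable {D} {X Y Z : CochainComplex (ModuleCat.{u} R) ℤ}

variable (D)

/-- The map `Hom_R(Y, D) ⟶ Hom_R(X, D)` induced by `f : X ⟶ Y`. -/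
def dualMap (f : X ⟶ Y) : dual D Y ⟶ dual D X where
  f n := ModuleCat.ofHom
    { toFun := fun z : Cochain Y D n => (Cochain.ofHom f).comp z (zero_add n)
      map_add' := fun z w => Cochain.comp_add _ _ _ _
      map_smul' := fun r z => Cochain.comp_smul _ _ _ _ }
  comm' i j _ := by
    ext z : 2
    exact (δ_ofHom_comp f (show Cochain Y D i from z) j)

lemma dualMap_apply (f : X ⟶ Y) (n : ℤ) (z : Cochain Y D n) :
    ((dualMap D f).f n).hom z = (Cochain.ofHom f).comp z (zero_add n) := rfl

lemma dualMap_v (f : X ⟶ Y) (n : ℤ) (z : Cochain Y D n) (p q : ℤ) (h : p + n = q) :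
    Cochain.v (((dualMap D f).f n).hom z : Cochain X D n) p q h = f.f p ≫ z.v p q h := by
  rw [dualMap_apply, Cochain.zero_cochain_comp_v, Cochain.ofHom_v]

lemma dualMap_id : dualMap D (𝟙 X) = 𝟙 _ := by
  ext n z : 3
  exact Cochain.id_comp z

lemma dualMap_comp (f : X ⟶ Y) (g : Y ⟶ Z) : dualMap D (f ≫ g) = dualMap D g ≫ dualMap D f := by
  ext n z : 3
  have h (z : Cochain Z D n) : (Cochain.ofHom (f ≫ g)).comp z (zero_add n) =
      (Cochain.ofHom f).comp ((Cochain.ofHom g).comp z (zero_add n)) (zero_add n) := by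
    rw [Cochain.ofHom_comp, Cochain.comp_assoc_of_first_is_zero_cochain]
  exact h z

lemma dualMap_zero : dualMap D (0 : X ⟶ Y) = 0 := by
  ext n z : 3
  have h (z : Cochain Y D n) : (Cochain.ofHom (0 : X ⟶ Y)).comp z (zero_add n) = 0 := by
    rw [Cochain.ofHom_zero, Cochain.zero_comp]
  exact h z

/-- The contravariant functor `Hom_R(-, D)`. -/
def dualFunctor : (CochainComplex (ModuleCat.{u} R) ℤ)ᵒᵖ ⥤ CochainComplex (ModuleCat.{u} R) ℤ where
  obj X := dual D X.unop
  map f := dualMap D f.unop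
  map_id _ := dualMap_id D
  map_comp _ _ := dualMap_comp D _ _

variable (X) in
lemma dual_exactAt_iff (l n m : ℤ) (hl : l + 1 = n) (hm : n + 1 = m) :
    (dual D X).ExactAt n ↔
      ∀ z : Cochain X D n, δ n m z = 0 → ∃ w : Cochain X D l, δ l n w = z :=
  exactAt_iff_forall l n m hl hm

/-- The cone of `f` is acyclic and `D` is K-injective, so every cocycle on the cone with values in
`D` is a coboundary. Reading the cone as pairs of cochains on `X` and `Y` gives injectivity and
surjectivity on cohomology. -/
lemma quasiIso_dualMap [D.IsKInjective] (f : X ⟶ Y) [QuasiIso f] : QuasiIso (dualMap D f) := by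
  have hf : (mappingCone f).Acyclic := by
    have h : HomotopyCategory.quasiIso _ (ComplexShape.up ℤ)
        ((HomotopyCategory.quotient (ModuleCat.{u} R) (ComplexShape.up ℤ)).map f) := by
      rw [HomotopyCategory.quotient_map_mem_quasiIso_iff, HomologicalComplex.mem_quasiIso_iff]
      infer_instance
    rw [HomotopyCategory.quasiIso_eq_trW_subcategoryAcyclic] at h
    exact (HomotopyCategory.quotient_obj_mem_subcategoryAcyclic_iff_acyclic _).1
      ((ObjectProperty.trW_iff_of_distinguished _ _
        (HomotopyCategory.mappingCone_triangleh_distinguished f)).1 h)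
  rw [quasiIso_iff]
  intro n
  rw [quasiIsoAt_iff_isIso_homologyMap]
  refine isIso_homologyMap_of_forall _ (n - 1) n (n + 1) (by lia) rfl ?_ ?_
  · rintro (z : Cochain Y D n) (hz : δ n (n + 1) z = 0) ⟨(w : Cochain X D (n - 1)), hw⟩
    replace hw : δ (n - 1) n w = (Cochain.ofHom f).comp z (zero_add n) := hw
    -- The cocycle `z` on `Y` and a primitive `w` of its pullback to `X`, with the sign `(-1)^n`,
    -- form a cocycle on the cone; the `Y`-part of a primitive of the pair is a primitive of `z`.
    obtain ⟨γ, hγ⟩ := IsKInjective.eq_δ_of_cocycle (mappingCone.descCocycle f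
      (n.negOnePow • w) (Cocycle.mk z (n + 1) rfl hz) (show n - 1 + 1 = n by lia)
      (by rw [δ_units_smul, hw]; rfl)) hf (n - 1) (by lia)
    refine ⟨(Cochain.ofHom (mappingCone.inr f)).comp γ (zero_add _), ?_⟩
    change δ (n - 1) n _ = z
    rw [δ_ofHom_comp, hγ]
    exact mappingCone.inr_descCochain f (n.negOnePow • w) z (by lia)
  · rintro (z : Cochain X D n) (hz : δ n (n + 1) z = 0)
    have hn : n + 1 = n + 1 := rfl
    -- Extended by zero on `Y`, the cocycle `z` becomes a cocycle of degree `n + 1` on the cone. The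
    -- `Y`-part `w` of a primitive is, up to sign, a lift of the class of `z`, and the `X`-part `v`
    -- bounds the difference.
    obtain ⟨γ, hγ⟩ := IsKInjective.eq_δ_of_cocycle (mappingCone.descCocycle f z 0 hn (by rw [hz]; simp)) hf n rfl
    let w : Cochain Y D n := (Cochain.ofHom (mappingCone.inr f)).comp γ (zero_add n)
    let v : Cochain X D (n - 1) := (mappingCone.inl f).comp γ (by lia)
    have h1 : (mappingCone.inl f).comp (δ n (n + 1) γ) (show -1 + (n + 1) = n by lia) = z := by
      rw [hγ]
      exact mappingCone.inl_descCochain f z 0 hn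
    have h2 : δ (n - 1) n v = z + n.negOnePow • (Cochain.ofHom f).comp w (zero_add n) := by
      dsimp only [v, w]
      rw [δ_comp (mappingCone.inl f) γ _ 0 (n + 1) n (by lia) (by lia) rfl, h1,
        mappingCone.δ_inl, Cochain.ofHom_comp, Cochain.comp_assoc_of_first_is_zero_cochain]
    have h3 : δ n (n + 1) w = 0 := by
      dsimp only [w]
      rw [δ_ofHom_comp, hγ]
      exact mappingCone.inr_descCochain f z 0 hn
    refine ⟨(-n.negOnePow) • w, ?_, -v, ?_⟩
    · change δ n (n + 1) _ = 0
      rw [δ_units_smul, h3, smul_zero]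
    · change δ (n - 1) n (-v) = (Cochain.ofHom f).comp ((-n.negOnePow) • w) (zero_add n) - z
      rw [δ_neg, h2, Cochain.comp_units_smul, Units.neg_smul]
      abel

/-- The short complex obtained by applying `Hom_R(-, D)`. -/
def dualShortComplex (S : ShortComplex (CochainComplex (ModuleCat.{u} R) ℤ)) :
    ShortComplex (CochainComplex (ModuleCat.{u} R) ℤ) :=
  ShortComplex.mk (dualMap D S.g) (dualMap D S.f) (by rw [← dualMap_comp, S.zero, dualMap_zero])

/-- A cochain is a family of maps with no compatibility between them, so exactness is checked one
component at a time, for `Hom(-, D^q)` with `D^q` injective. -/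
lemma dualShortComplex_shortExact [hD : ∀ n, Injective (D.X n)]
    (S : ShortComplex (CochainComplex (ModuleCat.{u} R) ℤ)) (hS : S.ShortExact) :
    (dualShortComplex D S).ShortExact := by
  have hS' (p : ℤ) := (HomologicalComplex.shortExact_iff_degreewise_shortExact S).1 hS p
  have hepi' (p : ℤ) := (hS' p).epi_g
  have hepi (p : ℤ) : Epi (S.g.f p) := hepi' p
  have hmono (p : ℤ) : Mono (S.f.f p) := (hS' p).mono_f
  apply HomologicalComplex.shortExact_of_degreewise_shortExact
  intro n
  apply ModuleCat.shortComplex_shortExact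
  · intro (z : Cochain S.X₂ D n)
    constructor
    · intro hz
      have hz' (p q : ℤ) (hpq : p + n = q) : S.f.f p ≫ z.v p q hpq = 0 := by
        rw [← dualMap_v]
        exact (congrArg (fun w : Cochain S.X₁ D n => w.v p q hpq) hz).trans (Cochain.zero_v _ _ _)
      refine ⟨(Cochain.mk fun p q hpq => (hS' p).exact.desc (z.v p q hpq) (hz' p q hpq) :
        Cochain S.X₃ D n), ?_⟩
      change ((dualMap D S.g).f n).hom _ = z
      refine Cochain.ext _ z fun p q hpq => ?_
      rw [dualMap_v]
      exact (hS' p).exact.g_desc _ _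
    · rintro ⟨w, rfl⟩
      have h : dualMap D S.g ≫ dualMap D S.f = 0 := (dualShortComplex D S).zero
      exact congrArg (fun f => (f.f n).hom w) h
  · refine (injective_iff_map_eq_zero ((dualMap D S.g).f n).hom).2 ?_
    intro (z : Cochain S.X₃ D n) hz
    change z = 0
    ext1 p q hpq
    rw [← cancel_epi (S.g.f p), ← dualMap_v, Cochain.zero_v, comp_zero]
    exact (congrArg (fun w : Cochain S.X₂ D n => w.v p q hpq) hz).trans (Cochain.zero_v _ _ _)
  · intro (z : Cochain S.X₁ D n)
    refine ⟨(Cochain.mk fun p q hpq => Injective.factorThru (z.v p q hpq) (S.f.f p) :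
      Cochain S.X₂ D n), ?_⟩
    change ((dualMap D S.f).f n).hom _ = z
    refine Cochain.ext _ z fun p q hpq => ?_
    rw [dualMap_v, Cochain.mk_v, Injective.comp_factorThru]

/-- Evaluation at `x : X^p`. -/
def evalAt {p q r : ℤ} (h : p + q = r) (x : X.X p) : (dual D X).X q ⟶ D.X r :=
  ModuleCat.ofHom
    { toFun := fun φ : Cochain X D q => (φ.v p r h).hom x
      map_add' := fun φ ψ => by rw [Cochain.add_v]; rfl
      map_smul' := fun a φ => by rw [Cochain.smul_v]; rfl }

lemma evalAt_apply {p q r : ℤ} (h : p + q = r) (x : X.X p) (φ : Cochain X D q) :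
    (evalAt D h x).hom φ = (φ.v p r h).hom x := rfl

lemma evalAt_add {p q r : ℤ} (h : p + q = r) (x y : X.X p) :
    evalAt D h (x + y) = evalAt D h x + evalAt D h y := by
  ext1
  exact LinearMap.ext fun (φ : Cochain X D q) => map_add (φ.v p r h).hom x y

lemma evalAt_smul {p q r : ℤ} (h : p + q = r) (a : R) (x : X.X p) :
    evalAt D h (a • x) = a • evalAt D h x := by
  ext1
  exact LinearMap.ext fun (φ : Cochain X D q) => map_smul (φ.v p r h).hom a x

/-- The cochain `φ ↦ ± φ(x)` on `Hom_R(X, D)` attached to `x : X^p`. -/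
def evalCochain {p : ℤ} (x : X.X p) : Cochain (dual D X) D p :=
  Cochain.mk fun q _ h => (p * q).negOnePow • evalAt D (by lia) x

lemma evalCochain_v {p : ℤ} (x : X.X p) (q r : ℤ) (h : q + p = r) :
    (evalCochain D x).v q r h = (p * q).negOnePow • evalAt D (by lia) x := rfl

/-- The sign `(-1)^(pq)` in `evalCochain` is the Koszul sign for exchanging `x` and `φ`. With it the
two terms containing `d(φ(x))` cancel (`e₁`) and the term `φ(dx)` gets the right sign (`e₂`). -/
lemma δ_evalCochain {p p' : ℤ} (hp : p + 1 = p') (x : X.X p) :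
    δ p p' (evalCochain D x) = evalCochain D ((X.d p p').hom x) := by
  ext1 q r h
  ext1
  refine LinearMap.ext fun (φ : Cochain X D q) => ?_
  rw [δ_v p p' hp _ q r h (r - 1) (q + 1) rfl rfl]
  change (D.d (r - 1) r).hom ((p * q).negOnePow • (φ.v p (r - 1) (by lia)).hom x) +
    p'.negOnePow • ((p * (q + 1)).negOnePow • ((δ q (q + 1) φ).v p r (by lia)).hom x) =
      (p' * q).negOnePow • (φ.v p' r (by lia)).hom ((X.d p p').hom x)
  rw [δ_v q (q + 1) rfl φ p r (by lia) (r - 1) p' rfl hp]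
  change _ + p'.negOnePow • ((p * (q + 1)).negOnePow •
    ((D.d (r - 1) r).hom ((φ.v p (r - 1) (by lia)).hom x) +
      (q + 1).negOnePow • (φ.v p' r (by lia)).hom ((X.d p p').hom x))) = _
  have e₁ : p'.negOnePow * (p * (q + 1)).negOnePow = -(p * q).negOnePow := by
    rw [← Int.negOnePow_succ, ← Int.negOnePow_add, Int.negOnePow_eq_iff]
    exact ⟨p, by rw [← hp]; ring⟩
  have e₂ : p'.negOnePow * (p * (q + 1)).negOnePow * (q + 1).negOnePow = (p' * q).negOnePow := by
    rw [← Int.negOnePow_add, ← Int.negOnePow_add, Int.negOnePow_eq_iff]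
    exact ⟨p + 1, by rw [← hp]; ring⟩
  rw [smul_add, smul_add, smul_smul, smul_smul, smul_smul, e₂, e₁]
  simp only [Units.smul_def, map_zsmul, Units.val_neg, neg_smul]
  abel

variable (X) in
/-- The evaluation `X ⟶ Hom_R(Hom_R(X, D), D)`. -/
def evalDual : X ⟶ dual D (dual D X) where
  f p := ModuleCat.ofHom
    { toFun := fun x => (evalCochain D x : Cochain (dual D X) D p)
      map_add' := fun x y => by
        ext1 q r h
        rw [Cochain.add_v, evalCochain_v, evalCochain_v, evalCochain_v, evalAt_add, smul_add]
      map_smul' := fun a x => by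
        change (evalCochain D (a • x) : Cochain (dual D X) D p) = a • evalCochain D x
        ext1 q r h
        rw [Cochain.smul_v, evalCochain_v, evalCochain_v, evalAt_smul, smul_comm] }
  comm' i j hij := by
    ext x : 2
    exact δ_evalCochain D hij x

lemma evalDual_naturality (f : X ⟶ Y) :
    f ≫ evalDual D Y = evalDual D X ≫ dualMap D (dualMap D f) := by
  ext p x : 3
  have h : evalCochain D ((f.f p).hom x) =
      (Cochain.ofHom (dualMap D f)).comp (evalCochain D x) (zero_add p) := by
    ext1 q r h
    ext1
    refine LinearMap.ext fun (φ : Cochain Y D q) => ?_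
    rw [Cochain.zero_cochain_comp_v, Cochain.ofHom_v]
    change (p * q).negOnePow • (φ.v p r (by lia)).hom ((f.f p).hom x) =
      (p * q).negOnePow • (Cochain.v (((dualMap D f).f q).hom φ : Cochain X D q) p r (by lia)).hom x
    rw [dualMap_v]
    rfl
  exact h

end Dual

/-! ### Complexes concentrated in one degree, and biduality for the module `R`. -/

section Reflexive

open CochainComplex CochainComplex.HomComplex

variable {R : Type u} [CommRing R]

/-- The module `M`, viewed as a complex concentrated in degree `p`. -/
abbrev sg (p : ℤ) (M : ModuleCat.{u} R) : CochainComplex (ModuleCat.{u} R) ℤ :=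
  (CochainComplex.singleFunctor (ModuleCat.{u} R) p).obj M

/-- The element of degree `p` in `sg p M` attached to `x : M`. -/
def sgElt (p : ℤ) {M : ModuleCat.{u} R} (x : M) : (sg p M).X p :=
  (HomologicalComplex.singleObjXSelf (.up ℤ) p M).inv.hom x

lemma sgElt_surjective (p : ℤ) {M : ModuleCat.{u} R} : Function.Surjective (sgElt p (M := M)) :=
  ((ConcreteCategory.isIso_iff_bijective
    (HomologicalComplex.singleObjXSelf (.up ℤ) p M).inv).1 inferInstance).2

lemma sgElt_smul (p : ℤ) {M : ModuleCat.{u} R} (a : R) (x : M) :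
    sgElt p (a • x) = a • sgElt p x := map_smul _ _ _

lemma sg_d (p : ℤ) (M : ModuleCat.{u} R) (i j : ℤ) : (sg p M).d i j = 0 := by
  by_cases h : i = p
  · by_cases h' : j = p
    · exact (sg p M).shape _ _ (by simp; lia)
    · exact (HomologicalComplex.isZero_single_obj_X _ _ _ _ h').eq_of_tgt _ _
  · exact (HomologicalComplex.isZero_single_obj_X _ _ _ _ h).eq_of_src _ _

lemma isZero_sg_X (p : ℤ) (M : ModuleCat.{u} R) (i : ℤ) (h : i ≠ p) : IsZero ((sg p M).X i) :=
  HomologicalComplex.isZero_single_obj_X _ _ _ _ h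

variable {D : CochainComplex (ModuleCat.{u} R) ℤ}

lemma δ_sg_v {p : ℤ} {M : ModuleCat.{u} R} {n n' r r' : ℤ} (hn : n + 1 = n') (h : p + n = r)
    (h' : p + n' = r') (φ : Cochain (sg p M) D n) :
    (δ n n' φ).v p r' h' = φ.v p r h ≫ D.d r r' := by
  rw [δ_v n n' hn φ p r' h' r (p + 1) (by lia) rfl, sg_d, zero_comp, smul_zero, add_zero]

lemma evalAt_sgElt_bijective {p n r : ℤ} (h : p + n = r) :
    Function.Bijective (evalAt D h (sgElt p (1 : ModuleCat.of R R))).hom := by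
  constructor
  · refine (injective_iff_map_eq_zero _).2 fun (φ : Cochain (sg p (ModuleCat.of R R)) D n) hφ => ?_
    change φ = 0
    refine (Cochain.fromSingleEquiv h).injective ?_
    rw [map_zero]
    ext1
    exact LinearMap.ext_ring hφ
  · intro y
    refine ⟨Cochain.fromSingleMk (ModuleCat.ofHom (LinearMap.toSpanSingleton R _ y)) h, ?_⟩
    rw [evalAt_apply, Cochain.fromSingleMk_v]
    change (LinearMap.toSpanSingleton R _ y)
      ((HomologicalComplex.singleObjXSelf (.up ℤ) p (ModuleCat.of R R)).hom.hom
        ((HomologicalComplex.singleObjXSelf (.up ℤ) p (ModuleCat.of R R)).inv.hom 1)) = y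
    have := congrArg (fun f => f.hom (1 : R))
      (HomologicalComplex.singleObjXSelf (.up ℤ) p (ModuleCat.of R R)).inv_hom_id
    refine (congrArg (LinearMap.toSpanSingleton R _ y) this).trans ?_
    exact one_smul R y

variable (D) in
/-- The isomorphism `Hom_R(R, D) ≅ D`. -/
def dualUnit : dual D (sg 0 (ModuleCat.of R R)) ⟶ D where
  f n := evalAt D (zero_add n) (sgElt 0 (1 : ModuleCat.of R R))
  comm' i j hij := by
    ext1
    refine LinearMap.ext fun (φ : Cochain (sg 0 (ModuleCat.of R R)) D i) => ?_
    change (D.d i j).hom ((φ.v 0 i (zero_add i)).hom _) = ((δ i j φ).v 0 j (zero_add j)).hom _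
    rw [δ_sg_v hij (zero_add i)]
    rfl

instance : IsIso (dualUnit D) := by
  have (n : ℤ) : IsIso ((dualUnit D).f n) :=
    (ConcreteCategory.isIso_iff_bijective _).2 (evalAt_sgElt_bijective (zero_add n))
  exact HomologicalComplex.Hom.isIso_of_components _

/-- Through `Hom(R, D) ≅ D` the biduality map of `R` becomes the homothety map of `D`; this is how
the defining property of a dualizing complex enters. -/
lemma evalCochain_sgElt (r : R) :
    evalCochain D (sgElt 0 (r : ModuleCat.of R R)) =
      (Cochain.ofHom (dualUnit D)).comp (Cochain.ofHom (r • 𝟙 D)) (zero_add 0) := by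
  ext1 p
  rw [evalCochain_v, Cochain.zero_cochain_comp_v, Cochain.ofHom_v, Cochain.ofHom_v]
  have hr : sgElt 0 (r : ModuleCat.of R R) = r • sgElt 0 (1 : ModuleCat.of R R) := by
    rw [← sgElt_smul]
    congr 1
    exact (mul_one r).symm
  rw [hr, evalAt_smul, zero_mul, Int.negOnePow_zero, one_smul, HomologicalComplex.smul_f_apply,
    Linear.comp_smul, HomologicalComplex.id_f, Category.comp_id]
  rfl

lemma exists_δ_eq_of_homotopy_zero (K L : CochainComplex (ModuleCat.{u} R) ℤ) (n m : ℤ)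
    (hn : m + 1 = n) (hK : ∀ f : K ⟶ (CategoryTheory.shiftFunctor _ n).obj L, Nonempty (Homotopy f 0))
    (z : Cochain K L n) (hz : δ n (n + 1) z = 0) : ∃ w : Cochain K L m, δ m n w = z := by
  refine (mem_coboundaries_iff (Cocycle.mk z (n + 1) rfl hz) m hn).1 ?_
  rw [← CohomologyClass.toHom_mk_eq_zero_iff, CohomologyClass.toHom_mk,
    HomotopyCategory.quotient_map_eq_zero_iff]
  exact hK _

variable (D) in
-- After transport along `dualUnit`, the bidual of `R` is `Hom(D, D)`. Degree 0 is the bijectivity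
-- of the homothety map, the other degrees are `homotopic_zero`.
lemma quasiIso_evalDual_sg_one (hD : IsDualizingComplex D) :
    QuasiIso (evalDual D (sg 0 (ModuleCat.of R R))) := by
  have cancel {n : ℤ} (z : Cochain (dual D (sg 0 (ModuleCat.of R R))) D n) :
      (Cochain.ofHom (dualUnit D)).comp
        ((Cochain.ofHom (inv (dualUnit D))).comp z (zero_add n)) (zero_add n) = z := by
    rw [← Cochain.comp_assoc_of_first_is_zero_cochain, ← Cochain.ofHom_comp, IsIso.hom_inv_id,
      Cochain.id_comp]
  have cancel' {n : ℤ} (z : Cochain D D n) :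
      (Cochain.ofHom (inv (dualUnit D))).comp
        ((Cochain.ofHom (dualUnit D)).comp z (zero_add n)) (zero_add n) = z := by
    rw [← Cochain.comp_assoc_of_first_is_zero_cochain, ← Cochain.ofHom_comp, IsIso.inv_hom_id,
      Cochain.id_comp]
  rw [quasiIso_iff]
  intro n
  rw [quasiIsoAt_iff_isIso_homologyMap]
  by_cases hn : n = 0
  · subst hn
    refine isIso_homologyMap_of_forall _ (-1) 0 1 (by lia) (by lia) ?_ ?_
    · rintro x - ⟨(y : Cochain (dual D (sg 0 (ModuleCat.of R R))) D (-1)), hy⟩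
      obtain ⟨r, rfl⟩ := sgElt_surjective 0 x
      replace hy : δ (-1) 0 y = evalCochain D (sgElt 0 r) := hy
      rw [evalCochain_sgElt] at hy
      replace hy := congrArg (fun z => (Cochain.ofHom (inv (dualUnit D))).comp z (zero_add 0)) hy
      rw [cancel', ← δ_ofHom_comp] at hy
      have h0 : r = 0 := by
        refine hD.homothety_bijective.1 ?_
        refine HomotopyCategory.eq_of_homotopy _ _ ((Cochain.equivHomotopy _ _).symm
          ⟨(Cochain.ofHom (inv (dualUnit D))).comp y (zero_add (-1)), ?_⟩)
        · rw [hy, zero_smul, Cochain.ofHom_zero, add_zero]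
      refine ⟨0, ?_⟩
      rw [h0]
      exact (map_zero _).trans (map_zero _).symm
    · intro (z : Cochain (dual D (sg 0 (ModuleCat.of R R))) D 0) hz
      let z' := (Cochain.ofHom (inv (dualUnit D))).comp z (zero_add 0)
      have hz' : δ 0 1 z' = 0 := by
        dsimp only [z']
        rw [δ_ofHom_comp]
        replace hz : δ 0 1 z = 0 := hz
        rw [hz, Cochain.comp_zero]
      obtain ⟨r, hr⟩ := hD.homothety_bijective.2 ((HomotopyCategory.quotient _ _).map
        (Cocycle.homOf (Cocycle.mk z' 1 rfl hz')))
      obtain ⟨γ, hγ⟩ := Cochain.equivHomotopy _ _ (HomotopyCategory.homotopyOfEq _ _ hr)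
      refine ⟨sgElt 0 r, by rw [sg_d]; rfl,
        (Cochain.ofHom (dualUnit D)).comp γ (zero_add _), ?_⟩
      change δ (-1) 0 ((Cochain.ofHom (dualUnit D)).comp γ (zero_add _)) =
        evalCochain D (sgElt 0 r) - z
      rw [evalCochain_sgElt, δ_ofHom_comp]
      rw [Cocycle.cochain_ofHom_homOf_eq_coe] at hγ
      change Cochain.ofHom (r • 𝟙 D) = δ (-1) 0 γ + z' at hγ
      rw [hγ, Cochain.comp_add, cancel, add_sub_cancel_right]
  · refine isIso_homologyMap_of_forall _ (n - 1) n (n + 1) (by lia) (by lia) ?_ ?_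
    · intro x _ _
      exact ⟨0, @Subsingleton.elim _
        (ModuleCat.subsingleton_of_isZero (isZero_sg_X 0 _ n hn)) _ _⟩
    · intro (z : Cochain (dual D (sg 0 (ModuleCat.of R R))) D n) hz
      obtain ⟨w, hw⟩ := exists_δ_eq_of_homotopy_zero D D n (n - 1) (by lia)
        (hD.homotopic_zero n hn) ((Cochain.ofHom (inv (dualUnit D))).comp z (zero_add n)) (by
          rw [δ_ofHom_comp]
          replace hz : δ n (n + 1) z = 0 := hz
          rw [hz, Cochain.comp_zero])
      refine ⟨0, map_zero _, (-(Cochain.ofHom (dualUnit D)).comp w (zero_add _) :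
        Cochain (dual D (sg 0 (ModuleCat.of R R))) D (n - 1)), ?_⟩
      change δ (n - 1) n (-(Cochain.ofHom (dualUnit D)).comp w (zero_add _)) = _
      rw [δ_neg, δ_ofHom_comp, hw, cancel, map_zero]
      exact (zero_sub z).symm

end Reflexive

/-! ### Dévissage of finitely generated modules through free presentations. -/

section Devissage

variable {R : Type u} [CommRing R]

/-- The short exact sequence `0 ⟶ R ⟶ R^(s+1) ⟶ R^s ⟶ 0`. -/
def consShortComplex (R : Type u) [CommRing R] (s : ℕ) : ShortComplex (ModuleCat.{u} R) :=
  ShortComplex.mk (X₁ := ModuleCat.of R R) (X₂ := ModuleCat.of R (Fin (s + 1) → R))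
    (X₃ := ModuleCat.of R (Fin s → R))
    (ModuleCat.ofHom (LinearMap.single R (fun _ => R) 0))
    (ModuleCat.ofHom (LinearMap.funLeft R R Fin.succ)) (by
      ext1
      refine LinearMap.ext fun (x : R) => funext fun i => ?_
      exact Pi.single_eq_of_ne (M := fun _ => R) (Fin.succ_ne_zero i) x)

lemma consShortComplex_shortExact (s : ℕ) : (consShortComplex R s).ShortExact := by
  apply ModuleCat.shortComplex_shortExact
  · intro (x : Fin (s + 1) → R)
    constructor
    · intro hx
      refine ⟨x 0, ?_⟩
      change Pi.single 0 (x 0) = x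
      funext i
      refine Fin.cases ?_ (fun j => ?_) i
      · simp
      · rw [Pi.single_eq_of_ne (Fin.succ_ne_zero j)]
        exact (congrFun hx j).symm
    · rintro ⟨x, rfl⟩
      exact congrArg (fun f => f.hom x) (consShortComplex R s).zero
  · exact Pi.single_injective (M := fun _ : Fin (s + 1) => R) 0
  · exact LinearMap.funLeft_surjective_of_injective R R _ (Fin.succ_injective s)

lemma free_induction (P : ModuleCat.{u} R → Prop) (hzero : ∀ M, IsZero M → P M)
    (hone : P (ModuleCat.of R R))
    (hext : ∀ S : ShortComplex (ModuleCat.{u} R), S.ShortExact → P S.X₁ → P S.X₃ → P S.X₂)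
    (s : ℕ) : P (ModuleCat.of R (Fin s → R)) := by
  induction s with
  | zero => exact hzero _ (ModuleCat.isZero_of_subsingleton _)
  | succ s hs => exact hext _ (consShortComplex_shortExact s) hone hs

lemma exists_presentation [IsNoetherianRing R] (N : ModuleCat.{u} R) [Module.Finite R N] :
    ∃ (s : ℕ) (S : ShortComplex (ModuleCat.{u} R)), S.ShortExact ∧
      S.X₂ = ModuleCat.of R (Fin s → R) ∧ S.X₃ = N ∧ Module.Finite R S.X₁ := by
  obtain ⟨s, f, hf⟩ := Module.Finite.exists_fin' R N
  refine ⟨s, ShortComplex.mk (X₁ := ModuleCat.of R (LinearMap.ker f))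
    (X₂ := ModuleCat.of R (Fin s → R)) (ModuleCat.ofHom (LinearMap.ker f).subtype)
    (ModuleCat.ofHom f : _ ⟶ N) (by ext x : 2; exact x.2), ?_, rfl, rfl, ?_⟩
  · apply ModuleCat.shortComplex_shortExact
    · intro x
      exact ⟨fun hx => ⟨⟨x, hx⟩, rfl⟩, by rintro ⟨x, rfl⟩; exact x.2⟩
    · exact Subtype.val_injective
    · exact hf
  · exact inferInstanceAs (Module.Finite R (LinearMap.ker f))

/-- Dévissage for statements on finitely generated modules depending on a degree, which hold for
finite free modules and in low degrees. -/
lemma fg_induction [IsNoetherianRing R] (P : ℤ → ModuleCat.{u} R → Prop) (a : ℤ)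
    (hlow : ∀ p < a, ∀ M, P p M) (hfree : ∀ p (s : ℕ), P p (ModuleCat.of R (Fin s → R)))
    (hquot : ∀ p (S : ShortComplex (ModuleCat.{u} R)), S.ShortExact →
      P p S.X₂ → P (p - 1) S.X₁ → P p S.X₃)
    (p : ℤ) (N : ModuleCat.{u} R) [Module.Finite R N] : P p N := by
  -- The induction is on the distance from `p` to the low degrees: replacing `N` by the kernel of a
  -- free cover lowers `p` by one.
  obtain ⟨n, hn⟩ : ∃ n : ℕ, p < a + n := ⟨(p - a + 1).toNat, by lia⟩
  induction n generalizing p N with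
  | zero => exact hlow p (by lia) N
  | succ n ih =>
    obtain ⟨s, S, hS, h₂, rfl, h₁⟩ := exists_presentation N
    exact hquot p S hS (h₂ ▸ hfree p s) (ih (p - 1) _ (by push_cast at hn; lia))

end Devissage

/-! ### Biduality and finiteness of cohomology for finitely generated modules. -/

section

open CochainComplex CochainComplex.HomComplex

variable {R : Type u} [CommRing R] (D : CochainComplex (ModuleCat.{u} R) ℤ)

lemma sg_shortExact (p : ℤ) (S : ShortComplex (ModuleCat.{u} R)) (hS : S.ShortExact) :
    (S.map (CochainComplex.singleFunctor (ModuleCat.{u} R) p)).ShortExact :=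
  hS.map_of_exact (HomologicalComplex.single (ModuleCat.{u} R) (ComplexShape.up ℤ) p)

lemma isZero_dual_X {X : CochainComplex (ModuleCat.{u} R) ℤ} (n : ℤ)
    (h : ∀ p q, p + n = q → IsZero (X.X p) ∨ IsZero (D.X q)) : IsZero ((dual D X).X n) := by
  have : Subsingleton (Cochain X D n) := by
    refine subsingleton_of_forall_eq 0 fun z => ?_
    ext1 p q hpq
    rcases h p q hpq with h | h
    · exact h.eq_of_src _ _
    · exact h.eq_of_tgt _ _
  exact @ModuleCat.isZero_of_subsingleton R _ (ModuleCat.of R (Cochain X D n)) this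

lemma isZero_dual_sg_X (p n : ℤ) (M : ModuleCat.{u} R) (h : IsZero (D.X (p + n))) :
    IsZero ((dual D (sg p M)).X n) := by
  refine isZero_dual_X D n fun p' q hpq => ?_
  by_cases hp : p' = p
  · subst hp hpq
    exact Or.inr h
  · exact Or.inl (isZero_sg_X p M p' hp)

lemma exactAt_of_isZero_X {K : CochainComplex (ModuleCat.{u} R) ℤ} {n : ℤ} (h : IsZero (K.X n)) :
    K.ExactAt n := by
  rw [exactAt_iff_forall (n - 1) n (n + 1) (by lia) rfl]
  intro x _
  exact ⟨0, @Subsingleton.elim _ (ModuleCat.subsingleton_of_isZero h) _ _⟩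

/-- The map from a short complex to its double dual. -/
def evalDualShortComplex (S : ShortComplex (CochainComplex (ModuleCat.{u} R) ℤ)) :
    S ⟶ dualShortComplex D (dualShortComplex D S) where
  τ₁ := evalDual D S.X₁
  τ₂ := evalDual D S.X₂
  τ₃ := evalDual D S.X₃
  comm₁₂ := (evalDual_naturality D S.f).symm
  comm₂₃ := (evalDual_naturality D S.g).symm

lemma quasiIso_τ₂ {S T : ShortComplex (CochainComplex (ModuleCat.{u} R) ℤ)} (hS : S.ShortExact)
    (hT : T.ShortExact) (φ : S ⟶ T) (h₁ : QuasiIso φ.τ₁) (h₃ : QuasiIso φ.τ₃) :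
    QuasiIso φ.τ₂ := by
  let := HasDerivedCategory.standard (ModuleCat.{u} R)
  rw [← DerivedCategory.isIso_Q_map_iff_quasiIso] at h₁ h₃ ⊢
  exact Pretriangulated.isIso₂_of_isIso₁₃ (DerivedCategory.triangleOfSES.map hS hT φ)
    (DerivedCategory.triangleOfSES_distinguished hS)
    (DerivedCategory.triangleOfSES_distinguished hT) h₁ h₃

variable {D}

lemma IsDualizingComplex.isKInjective (hD : IsDualizingComplex D) : D.IsKInjective := by
  obtain ⟨a, b, hab⟩ := hD.bounded
  have : D.IsStrictlyGE a := by
    rw [CochainComplex.isStrictlyGE_iff]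
    exact fun i hi => hab i (Or.inl hi)
  have := hD.injective
  exact CochainComplex.isKInjective_of_injective D a

lemma quasiIso_evalDual_sg_free (hD : IsDualizingComplex D) (s : ℕ) :
    QuasiIso (evalDual D (sg 0 (ModuleCat.of R (Fin s → R)))) := by
  have := hD.injective
  refine free_induction (fun M => QuasiIso (evalDual D (sg 0 M))) ?_
    (quasiIso_evalDual_sg_one D hD) ?_ s
  · intro M hM
    have h : IsZero (sg 0 M) := Functor.map_isZero (singleFunctor (ModuleCat.{u} R) 0) hM
    have h' (X : CochainComplex (ModuleCat.{u} R) ℤ) (hX : IsZero X) : IsZero (dual D X) := by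
      rw [IsZero.iff_id_eq_zero] at hX ⊢
      rw [← dualMap_id, hX, dualMap_zero]
    rw [show evalDual D (sg 0 M) = (h.iso (h' _ (h' _ h))).hom from h.eq_of_src _ _]
    infer_instance
  · intro S hS h₁ h₃
    exact quasiIso_τ₂ (sg_shortExact 0 S hS)
      (dualShortComplex_shortExact D _ (dualShortComplex_shortExact D _ (sg_shortExact 0 S hS)))
      (evalDualShortComplex D (S.map (singleFunctor (ModuleCat.{u} R) 0))) h₁ h₃

/-- Biduality for finitely generated modules. -/
theorem quasiIso_evalDual_sg [IsNoetherianRing R] (hD : IsDualizingComplex D)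
    (N : ModuleCat.{u} R) [Module.Finite R N] : QuasiIso (evalDual D (sg 0 N)) := by
  have := hD.injective
  obtain ⟨a, b, hab⟩ := hD.bounded
  -- Epi in degree `-p` is paired with mono in degree `-p + 1` so that the four lemmas pass from
  -- `X₂` in degree `p` and `X₁` in degree `p - 1` to `X₃` in degree `p`. The induction starts below
  -- `min 0 (a - b)`: the bidual lives in degrees at most `b - a`, and the module has no cohomology
  -- in positive degrees.
  have key (p : ℤ) : Epi (HomologicalComplex.homologyMap (evalDual D (sg 0 N)) (-p)) ∧
      Mono (HomologicalComplex.homologyMap (evalDual D (sg 0 N)) (-p + 1)) := by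
    refine fg_induction (fun p N =>
      Epi (HomologicalComplex.homologyMap (evalDual D (sg 0 N)) (-p)) ∧
        Mono (HomologicalComplex.homologyMap (evalDual D (sg 0 N)) (-p + 1)))
      (min 0 (a - b)) ?_ ?_ ?_ p N
    · intro p hp M
      have h₁ : IsZero ((dual D (dual D (sg 0 M))).homology (-p)) := by
        rw [← HomologicalComplex.exactAt_iff_isZero_homology]
        refine exactAt_of_isZero_X (isZero_dual_X D _ fun i j hij => ?_)
        by_cases hj : b < j
        · exact Or.inr (hab j (Or.inr hj))
        · exact Or.inl (isZero_dual_sg_X D 0 i M (hab _ (Or.inl (by lia))))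
      have h₂ : IsZero ((sg 0 M).homology (-p + 1)) := by
        rw [← HomologicalComplex.exactAt_iff_isZero_homology]
        exact exactAt_of_isZero_X (isZero_sg_X 0 M _ (by lia))
      exact ⟨⟨fun _ _ _ => h₁.eq_of_src _ _⟩, ⟨fun _ _ _ => h₂.eq_of_tgt _ _⟩⟩
    · intro p s
      have := quasiIso_evalDual_sg_free hD s
      constructor <;> infer_instance
    · intro p S hS h₂ h₁
      have e₁ : -(p - 1) = -p + 1 := by lia
      rw [e₁] at h₁
      have hS' := sg_shortExact 0 S hS
      have hT := dualShortComplex_shortExact D _ (dualShortComplex_shortExact D _ hS')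
      let φ := evalDualShortComplex D (S.map (singleFunctor (ModuleCat.{u} R) 0))
      constructor
      · refine HomologicalComplex.HomologySequence.epi_homologyMap_τ₃ φ hS' hT (-p) h₂.1 ?_ ?_
        · rintro j rfl
          exact h₁.1
        · rintro j rfl
          exact h₂.2
      · refine HomologicalComplex.HomologySequence.mono_homologyMap_τ₃ φ hS' hT (-p + 1)
          h₁.1 h₂.2 ?_
        rintro j rfl
        exact h₁.2
  rw [quasiIso_iff]
  intro n
  rw [quasiIsoAt_iff_isIso_homologyMap]
  have h₁ := (key (-n)).1
  have h₂ := (key (-n + 1)).2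
  rw [neg_neg] at h₁
  rw [show -(-n + 1) + 1 = n by lia] at h₂
  exact isIso_of_mono_of_epi _

lemma finite_of_exact [IsNoetherianRing R] (S : ShortComplex (ModuleCat.{u} R)) (hS : S.Exact)
    [Module.Finite R S.X₁] [Module.Finite R S.X₃] : Module.Finite R S.X₂ := by
  rw [ShortComplex.moduleCat_exact_iff_range_eq_ker] at hS
  have : IsNoetherian R S.X₂ := isNoetherian_of_range_eq_ker S.f.hom S.g.hom hS
  infer_instance

lemma finite_of_isZero {M : ModuleCat.{u} R} (h : IsZero M) : Module.Finite R M :=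
  have := ModuleCat.subsingleton_of_isZero h
  inferInstance

lemma finite_of_iso {M N : ModuleCat.{u} R} (e : M ≅ N) [Module.Finite R M] : Module.Finite R N :=
  Module.Finite.equiv e.toLinearEquiv

lemma finite_homology_dual_sg [IsNoetherianRing R] (hD : IsDualizingComplex D) (n : ℤ)
    (N : ModuleCat.{u} R) [Module.Finite R N] : Module.Finite R ((dual D (sg 0 N)).homology n) := by
  have := hD.injective
  obtain ⟨a, b, hab⟩ := hD.bounded
  refine fg_induction (fun p N => Module.Finite R ((dual D (sg 0 N)).homology p)) a ?_ ?_ ?_ n N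
  · intro p hp M
    refine finite_of_isZero ?_
    rw [← HomologicalComplex.exactAt_iff_isZero_homology]
    exact exactAt_of_isZero_X (isZero_dual_sg_X D 0 p M (hab _ (Or.inl (by lia))))
  · intro p s
    refine free_induction (fun M => Module.Finite R ((dual D (sg 0 M)).homology p)) ?_ ?_ ?_ s
    · intro M hM
      refine finite_of_isZero ?_
      rw [← HomologicalComplex.exactAt_iff_isZero_homology]
      refine exactAt_of_isZero_X (isZero_dual_X D _ fun i j _ => Or.inl ?_)
      exact Functor.map_isZero (HomologicalComplex.eval _ _ i)
        (Functor.map_isZero (singleFunctor (ModuleCat.{u} R) 0) hM)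
    · have := hD.finite p
      exact finite_of_iso (HomologicalComplex.homologyMapIso (asIso (dualUnit D)) p).symm
    · intro S hS h₁ h₃
      have hT := dualShortComplex_shortExact D _ (sg_shortExact 0 S hS)
      exact @finite_of_exact R _ _ _ (hT.homology_exact₂ p) h₃ h₁
  · intro p S hS h₂ h₁
    have hT := dualShortComplex_shortExact D _ (sg_shortExact 0 S hS)
    exact @finite_of_exact R _ _ _ (hT.homology_exact₁ (p - 1) p (by simp)) h₁ h₂

end

/-! ### `RHom_R(-, D)` on the derived category, and its faithfulness on maps to a reflexive complex.
-/

section DerivedDual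

open DerivedCategory

universe w

variable {R : Type u} [CommRing R] [HasDerivedCategory.{w} (ModuleCat.{u} R)]
  (D : CochainComplex (ModuleCat.{u} R) ℤ) [D.IsKInjective]

lemma dualFunctor_comp_Q_inverts :
    (HomologicalComplex.quasiIso (ModuleCat.{u} R) (ComplexShape.up ℤ)).op.IsInvertedBy
      (dualFunctor D ⋙ Q) := by
  intro X Y f hf
  have : QuasiIso f.unop := hf
  have : QuasiIso ((dualFunctor D).map f) := quasiIso_dualMap D f.unop
  rw [Functor.comp_map]
  infer_instance

/-- The derived functor `RHom_R(-, D)`. -/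
def derivedDual : (DerivedCategory (ModuleCat.{u} R))ᵒᵖ ⥤ DerivedCategory (ModuleCat.{u} R) :=
  Localization.lift (dualFunctor D ⋙ Q) (dualFunctor_comp_Q_inverts D) Q.op

/-- The functor `derivedDual` is induced by `dual`. -/
def derivedDualIso (X : CochainComplex (ModuleCat.{u} R) ℤ) :
    (derivedDual D).obj (.op (Q.obj X)) ≅ Q.obj (dual D X) :=
  (Localization.fac (dualFunctor D ⋙ Q) (dualFunctor_comp_Q_inverts D) Q.op).app (.op X)

lemma derivedDualIso_naturality {X Y : CochainComplex (ModuleCat.{u} R) ℤ} (f : X ⟶ Y) :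
    (derivedDual D).map (Q.map f).op ≫ (derivedDualIso D X).hom =
      (derivedDualIso D Y).hom ≫ Q.map (dualMap D f) :=
  (Localization.fac (dualFunctor D ⋙ Q) (dualFunctor_comp_Q_inverts D) Q.op).hom.naturality f.op

lemma Q_map_dualMap_eq {X Y : CochainComplex (ModuleCat.{u} R) ℤ} {f g : X ⟶ Y}
    (h : Q.map f = Q.map g) : Q.map (dualMap D f) = Q.map (dualMap D g) := by
  rw [← cancel_epi ((derivedDualIso D Y).hom), ← derivedDualIso_naturality,
    ← derivedDualIso_naturality, h]

/-- Write `α` as a fraction with numerator `g`. If its dual is zero, so is the double dual of `g`,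
and naturality of the biduality map, invertible at `Y`, gives `g = 0`. Nothing is asked of `X`. -/
lemma eq_zero_of_derivedDual_map_eq_zero {X Y : CochainComplex (ModuleCat.{u} R) ℤ}
    [QuasiIso (evalDual D Y)] (α : Q.obj X ⟶ Q.obj Y) (hα : (derivedDual D).map α.op = 0) :
    α = 0 := by
  obtain ⟨X', s, hs, g, rfl⟩ := right_fac α
  have h₁ : Q.map (dualMap D g) = 0 := by
    rw [← cancel_epi ((derivedDualIso D Y).hom), ← derivedDualIso_naturality]
    have h : (Q.map g).op = (inv (Q.map s) ≫ Q.map g).op ≫ (Q.map s).op := by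
      rw [← op_comp, IsIso.hom_inv_id_assoc]
    rw [h, Functor.map_comp, hα]
    simp
  have h₂ : Q.map (dualMap D (dualMap D g)) = 0 := by
    rw [← Q.map_zero] at h₁
    rw [Q_map_dualMap_eq D h₁, dualMap_zero, Q.map_zero]
  have h₃ := congrArg Q.map (evalDual_naturality D g)
  rw [Q.map_comp, Q.map_comp, h₂, comp_zero] at h₃
  have : Q.map g = 0 := by
    rw [← cancel_mono (Q.map (evalDual D Y)), h₃, zero_comp]
  rw [this, comp_zero]

end DerivedDual

/-! ### Exactness of `Hom_R(k, D)`, and then of `Hom_R(R/I, D)`, outside one degree. -/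

section HomExact

open CochainComplex CochainComplex.HomComplex IsLocalRing

variable {R : Type u} [CommRing R]

/-- The complex `Hom_R(M, D)` is exact in degree `i`. -/
def HomExactAt (D : CochainComplex (ModuleCat.{u} R) ℤ) (M : ModuleCat.{u} R) (i : ℤ) : Prop :=
  ∀ φ : M ⟶ D.X i, φ ≫ D.d i (i + 1) = 0 → ∃ ψ : M ⟶ D.X (i - 1), ψ ≫ D.d (i - 1) i = φ

variable {D : CochainComplex (ModuleCat.{u} R) ℤ}

lemma HomExactAt.exists_comp_eq {M : ModuleCat.{u} R}
    {l i m : ℤ} (h : HomExactAt D M i) (hl : l + 1 = i) (hm : i + 1 = m) (φ : M ⟶ D.X i)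
    (hφ : φ ≫ D.d i m = 0) : ∃ ψ : M ⟶ D.X l, ψ ≫ D.d l i = φ := by
  obtain rfl : l = i - 1 := by lia
  subst hm
  exact h φ hφ

lemma HomExactAt.of_shortExact (S : ShortComplex (ModuleCat.{u} R)) (hS : S.ShortExact) (i : ℤ)
    [Injective (D.X (i - 1))] (h₁ : HomExactAt D S.X₁ i) (h₃ : HomExactAt D S.X₃ i) :
    HomExactAt D S.X₂ i := by
  intro φ hφ
  have := hS.mono_f
  have := hS.epi_g
  obtain ⟨ψ₁, hψ₁⟩ := h₁ (S.f ≫ φ) (by rw [Category.assoc, hφ, comp_zero])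
  let ψ₂ := Injective.factorThru ψ₁ S.f
  have h0 : S.f ≫ (φ - ψ₂ ≫ D.d (i - 1) i) = 0 := by
    rw [Preadditive.comp_sub, Injective.comp_factorThru_assoc, hψ₁, sub_self]
  obtain ⟨ψ₃, hψ₃⟩ := h₃ (hS.exact.desc _ h0) (by
    rw [← cancel_epi S.g, ShortComplex.Exact.g_desc_assoc, Preadditive.sub_comp, hφ,
      Category.assoc, D.d_comp_d, comp_zero, sub_zero, comp_zero])
  refine ⟨ψ₂ + S.g ≫ ψ₃, ?_⟩
  rw [Preadditive.add_comp, Category.assoc, hψ₃, ShortComplex.Exact.g_desc]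
  abel

variable [IsLocalRing R]

lemma smul_resField (a : R) (ha : a ∈ maximalIdeal R) (x : resField R) : a • x = 0 := by
  rw [Algebra.smul_def, show algebraMap R (ResidueField R) a = 0 from
    (residue_eq_zero_iff a).2 ha, zero_mul]

lemma resField_hom_ext {M : ModuleCat.{u} R} {f g : resField R ⟶ M}
    (h : f.hom (1 : ResidueField R) = g.hom (1 : ResidueField R)) : f = g := by
  ext x
  obtain ⟨r, rfl⟩ := toResField_surjective x
  have e : (toResField R).hom r = r • (1 : ResidueField R) := Algebra.algebraMap_eq_smul_one r
  rw [e]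
  exact (map_smul f.hom r _).trans ((congrArg (r • ·) h).trans (map_smul g.hom r _).symm)

lemma exists_resField_hom {M : ModuleCat.{u} R} (x : M) (hx : ∀ a ∈ maximalIdeal R, a • x = 0) :
    ∃ f : resField R ⟶ M, f.hom (1 : ResidueField R) = x :=
  ⟨ModuleCat.ofHom ((maximalIdeal R).liftQ (LinearMap.toSpanSingleton R M x)
    (fun a ha => hx a ha)), one_smul R x⟩

/-- A nonzero vector in a module killed by the maximal ideal is detected by a map to `k`. -/
lemma exists_hom_resField (M : Type u) [AddCommGroup M] [Module R M]
    (hM : ∀ a ∈ maximalIdeal R, ∀ x : M, a • x = 0) (p : Submodule R M) (v : M) (hv : v ∉ p) :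
    ∃ f : M →ₗ[R] ResidueField R, f v = 1 ∧ p ≤ LinearMap.ker f := by
  have hW : Module.IsTorsionBySet R (M ⧸ p) (maximalIdeal R) := by
    rintro x ⟨a, ha⟩
    obtain ⟨y, rfl⟩ := p.mkQ_surjective x
    change a • p.mkQ y = 0
    rw [← map_smul, hM a ha, map_zero]
  let : Module (ResidueField R) (M ⧸ p) := hW.module
  have : IsScalarTower R (ResidueField R) (M ⧸ p) := hW.isScalarTower
  have hv' : p.mkQ v ∉ (⊥ : Submodule (ResidueField R) (M ⧸ p)) := by
    simpa using hv
  obtain ⟨f, hf, -⟩ := Submodule.exists_le_ker_of_notMem hv'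
  refine ⟨(((f (p.mkQ v))⁻¹ • f).restrictScalars R) ∘ₗ p.mkQ, inv_mul_cancel₀ hf, ?_⟩
  intro x hx
  have hx' : p.mkQ x = 0 := by simpa using hx
  rw [LinearMap.mem_ker, LinearMap.comp_apply, hx', map_zero]

lemma smul_dual_sg_resField (a : R) (ha : a ∈ maximalIdeal R) (n : ℤ)
    (z : Cochain (sg 0 (resField R)) D n) : a • z = 0 := by
  refine (Cochain.fromSingleEquiv (zero_add n)).injective ?_
  rw [map_zero]
  refine resField_hom_ext ?_
  change a • ((Cochain.fromSingleEquiv (zero_add n)) z).hom (1 : ResidueField R) = 0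
  rw [← map_smul]
  exact (congrArg _ (smul_resField a ha _)).trans (map_zero _)

/-- The bidual of `k` has no cohomology in degree `a - b ≠ 0`. Suppose `φ` and `v` are cocycles of
degrees `a` and `b` that are not coboundaries. Since `Hom(k, D)` is killed by `𝔪`, linear algebra
gives a functional `ℓ` with `ℓ(v) = 1` that vanishes on coboundaries. Then `φ ∘ ℓ` is a cocycle of
degree `a - b` of the bidual, hence some `δ w`; evaluation at `v` gives `φ(1) = d(w(v))`. As `w(v)`
is killed by `𝔪`, it defines a map from `k` with coboundary `φ`, a contradiction. -/
lemma homExactAt_resField_or [QuasiIso (evalDual D (sg 0 (resField R)))] (a b : ℤ) (hab : a ≠ b) :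
    HomExactAt D (resField R) a ∨ HomExactAt D (resField R) b := by
  by_contra! h
  obtain ⟨ha, hb⟩ := h
  simp only [HomExactAt, not_forall] at ha hb
  obtain ⟨φ, hφ, hφ'⟩ := ha
  obtain ⟨χ, hχ, hχ'⟩ := hb
  let v : Cochain (sg 0 (resField R)) D b := Cochain.fromSingleMk χ (zero_add b)
  have hv : δ b (b + 1) v = 0 := by
    dsimp only [v]
    rw [Cochain.δ_fromSingleMk χ (zero_add b) (b + 1) (b + 1) (by lia), hχ,
      Cochain.fromSingleMk_zero]
  have hv' : v ∉ LinearMap.range (δ_hom R (sg 0 (resField R)) D (b - 1) b) := by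
    rintro ⟨w, hw⟩
    replace hw : δ (b - 1) b w = v := hw
    obtain ⟨ψ, rfl⟩ := Cochain.fromSingleMk_surjective w (b - 1) (zero_add _)
    rw [Cochain.δ_fromSingleMk ψ (zero_add _) b b (by lia)] at hw
    exact hχ' ⟨ψ, (Cochain.fromSingleEquiv (zero_add b)).symm.injective hw⟩
  obtain ⟨ℓ, hℓ, hℓ'⟩ : ∃ ℓ : (dual D (sg 0 (resField R))).X b ⟶ resField R,
      ℓ.hom v = (1 : ResidueField R) ∧ (dual D (sg 0 (resField R))).d (b - 1) b ≫ ℓ = 0 := by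
    obtain ⟨ℓ, hℓ, hℓ'⟩ := exists_hom_resField (Cochain (sg 0 (resField R)) D b)
      (fun r hr x => smul_dual_sg_resField r hr b x) _ v hv'
    refine ⟨ModuleCat.ofHom ℓ, hℓ, ?_⟩
    ext1
    exact LinearMap.ext fun x => hℓ' ⟨x, rfl⟩
  let c : Cochain (dual D (sg 0 (resField R))) D (a - b) :=
    Cochain.single (p := b) (q := a) (ℓ ≫ φ) (a - b)
  have hc : δ (a - b) (a - b + 1) c = 0 := by
    dsimp only [c]
    rw [Cochain.δ_single _ (a - b) (a - b + 1) rfl (b - 1) (a + 1) (by lia) rfl, Category.assoc,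
      hφ, comp_zero, reassoc_of% hℓ', zero_comp]
    simp
  have hex : (dual D (dual D (sg 0 (resField R)))).ExactAt (a - b) := by
    rw [HomologicalComplex.exactAt_iff_isZero_homology,
      ← (isoOfQuasiIsoAt (evalDual D (sg 0 (resField R))) (a - b)).isZero_iff,
      ← HomologicalComplex.exactAt_iff_isZero_homology]
    exact exactAt_of_isZero_X (isZero_sg_X 0 _ _ (by lia))
  obtain ⟨w, hw⟩ := (dual_exactAt_iff D _ (a - b - 1) (a - b) (a - b + 1) (by lia) rfl).1 hex c hc
  let y : D.X (a - 1) := (w.v b (a - 1) (by lia)).hom v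
  have hy : (D.d (a - 1) a).hom y = φ.hom (1 : ResidueField R) := by
    have h₁ := congrArg (fun z => ((Cochain.v z b a (by lia) : _ ⟶ D.X a)).hom v) hw
    dsimp only [c] at h₁
    rw [Cochain.single_v, δ_v (a - b - 1) (a - b) (by lia) w b a (by lia) (a - 1) (b + 1)
      (by lia) rfl] at h₁
    have h₂ : ((dual D (sg 0 (resField R))).d b (b + 1)).hom v = 0 := hv
    have h₃ : (D.d (a - 1) a).hom y + (a - b).negOnePow • (w.v (b + 1) a (by lia)).hom
      (((dual D (sg 0 (resField R))).d b (b + 1)).hom v) = φ.hom (ℓ.hom v) := h₁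
    rwa [h₂, map_zero, smul_zero, add_zero, hℓ] at h₃
  obtain ⟨ψ, hψ⟩ := exists_resField_hom y (fun r hr => by
    refine (map_smul (w.v b (a - 1) (by lia)).hom r _).symm.trans ?_
    exact (congrArg _ (smul_dual_sg_resField r hr b v)).trans (map_zero _))
  refine hφ' ⟨ψ, resField_hom_ext ?_⟩
  rw [← hy, ← hψ]
  rfl

lemma exists_homExactAt_resField [QuasiIso (evalDual D (sg 0 (resField R)))] :
    ∃ t : ℤ, ∀ i ≠ t, HomExactAt D (resField R) i := by
  by_cases h : ∃ t, ¬ HomExactAt D (resField R) t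
  · obtain ⟨t, ht⟩ := h
    exact ⟨t, fun i hi => (homExactAt_resField_or i t hi).resolve_right ht⟩
  · exact ⟨0, fun i _ => not_not.1 fun hi => h ⟨i, hi⟩⟩

/-- The short exact sequence `0 ⟶ k ⟶ R/I ⟶ R/(I + xR) ⟶ 0` attached to `x ∉ I` with
`𝔪 x ⊆ I`. -/
lemma exists_socle_shortExact (I : Ideal R) (x : R) (hx : x ∉ I)
    (hmx : ∀ a ∈ maximalIdeal R, a * x ∈ I) :
    ∃ S : ShortComplex (ModuleCat.{u} R), S.ShortExact ∧ S.X₁ = resField R ∧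
      S.X₂ = ModuleCat.of R (R ⧸ I) ∧ S.X₃ = ModuleCat.of R (R ⧸ (I ⊔ Ideal.span {x})) := by
  let f : ResidueField R →ₗ[R] R ⧸ I := (maximalIdeal R).liftQ
    (I.mkQ ∘ₗ LinearMap.toSpanSingleton R R x) (fun a ha => by
      rw [LinearMap.mem_ker, LinearMap.comp_apply]
      exact (Submodule.Quotient.mk_eq_zero I).2 (hmx a ha))
  have hf (r : R) : f (residue R r) = I.mkQ (r * x) := rfl
  let g : (R ⧸ I) →ₗ[R] R ⧸ (I ⊔ Ideal.span {x}) := Submodule.factor le_sup_left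
  have hg (r : R) : g (I.mkQ r) = (I ⊔ Ideal.span {x}).mkQ r := rfl
  refine ⟨ShortComplex.mk (X₁ := resField R) (X₂ := ModuleCat.of R (R ⧸ I))
    (X₃ := ModuleCat.of R (R ⧸ (I ⊔ Ideal.span {x}))) (ModuleCat.ofHom f) (ModuleCat.ofHom g) ?_,
    ?_, rfl, rfl, rfl⟩
  · ext1
    refine LinearMap.ext fun (y : ResidueField R) => ?_
    obtain ⟨r, rfl⟩ := residue_surjective y
    change g (f (residue R r)) = 0
    rw [hf, hg]
    exact (Submodule.Quotient.mk_eq_zero _).2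
      (Ideal.mem_sup_right (Ideal.mul_mem_left _ r (Ideal.mem_span_singleton_self x)))
  · apply ModuleCat.shortComplex_shortExact
    · intro (y : R ⧸ I)
      obtain ⟨r, rfl⟩ := I.mkQ_surjective y
      constructor
      · intro (h : g (I.mkQ r) = 0)
        rw [hg] at h
        replace h := (Submodule.Quotient.mk_eq_zero _).1 h
        obtain ⟨s, hs, b, hb, rfl⟩ := Submodule.mem_sup.1 h
        obtain ⟨c, rfl⟩ := Ideal.mem_span_singleton'.1 hb
        refine ⟨residue R c, ?_⟩
        change f (residue R c) = I.mkQ (s + c * x)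
        rw [hf, map_add, (Submodule.Quotient.mk_eq_zero I).2 hs |> (id : I.mkQ s = 0 → _),
          zero_add]
      · rintro ⟨z, hz⟩
        obtain ⟨c, rfl⟩ := residue_surjective z
        change f (residue R c) = _ at hz
        rw [← hz, hf]
        change g (I.mkQ (c * x)) = 0
        rw [hg]
        exact (Submodule.Quotient.mk_eq_zero _).2
          (Ideal.mem_sup_right (Ideal.mul_mem_left _ c (Ideal.mem_span_singleton_self x)))
    · refine (injective_iff_map_eq_zero f).2 fun y hy => ?_
      obtain ⟨r, rfl⟩ := residue_surjective y
      rw [residue_eq_zero_iff]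
      by_contra hr
      rw [hf] at hy
      replace hy : r * x ∈ I := (Submodule.Quotient.mk_eq_zero I).1 hy
      have hu : IsUnit r := by
        by_contra hu
        exact hr hu
      exact hx ((Ideal.unit_mul_mem_iff_mem I hu).1 hy)
    · exact Submodule.factor_surjective le_sup_left

/-- If `m + 1` is the least exponent with `𝔪^(m+1) ≤ I`, any element of `𝔪^m` outside `I` will do;
the least exponent is not 0 because `I` is proper. -/
lemma exists_socle_elt (I : Ideal R) (hI : I ≠ ⊤) (n : ℕ) (hn : maximalIdeal R ^ n ≤ I) :
    ∃ x ∉ I, ∀ a ∈ maximalIdeal R, a * x ∈ I := by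
  classical
  have hex : ∃ n, maximalIdeal R ^ n ≤ I := ⟨n, hn⟩
  obtain ⟨m, hm⟩ : ∃ m, Nat.find hex = m + 1 := by
    refine Nat.exists_eq_succ_of_ne_zero fun h0 => hI ?_
    have := Nat.find_spec hex
    rwa [h0, pow_zero, Ideal.one_eq_top, top_le_iff] at this
  have h₁ : ¬ maximalIdeal R ^ m ≤ I := Nat.find_min hex (by lia)
  obtain ⟨x, hx, hxI⟩ := SetLike.not_le_iff_exists.1 h₁
  refine ⟨x, hxI, fun a ha => Nat.find_spec hex ?_⟩
  rw [hm, pow_succ, mul_comm a]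
  exact Ideal.mul_mem_mul hx ha

/-- Dévissage: if `Hom_R(k, D)` is exact in degree `i`, so is `Hom_R(R/I, D)` for every ideal
`I` containing a power of `𝔪`. -/
lemma HomExactAt.quotient [IsNoetherianRing R] [∀ n, Injective (D.X n)] {i : ℤ}
    (h : HomExactAt D (resField R) i) (I : Ideal R) (n : ℕ) (hn : maximalIdeal R ^ n ≤ I) :
    HomExactAt D (ModuleCat.of R (R ⧸ I)) i := by
  induction I using IsNoetherian.induction with
  | hgt I ih =>
    by_cases hI : I = ⊤
    · subst hI
      intro φ _
      have h0 : IsZero (ModuleCat.of R (R ⧸ (⊤ : Ideal R))) :=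
        @ModuleCat.isZero_of_subsingleton R _ (ModuleCat.of R (R ⧸ (⊤ : Ideal R)))
          (Submodule.Quotient.subsingleton_iff.2 rfl)
      exact ⟨0, h0.eq_of_src _ _⟩
    · obtain ⟨x, hx, hmx⟩ := exists_socle_elt I hI n hn
      obtain ⟨S, hS, h₁, h₂, h₃⟩ := exists_socle_shortExact I x hx hmx
      rw [← h₂]
      refine HomExactAt.of_shortExact S hS i (h₁ ▸ h) ?_
      rw [h₃]
      refine ih _ (left_lt_sup.2 fun hle => hx (hle (Ideal.mem_span_singleton_self x)))
        (hn.trans le_sup_left)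

end HomExact

/-! ### Injectivity of the torsion submodule of an injective module. -/

section TorsionInjective

open IsLocalRing

variable {R : Type u} [CommRing R]

lemma exists_pow_smul_eq_zero [IsNoetherianRing R] (I : Ideal R) (M : ModuleCat.{u} R)
    (htor : ∀ x : M, x ∈ powerTorsion I M) (J : Ideal R) (g : J →ₗ[R] M) :
    ∃ n : ℕ, ∀ x : J, ∀ a ∈ I ^ n, a • g x = 0 := by
  obtain ⟨s, hs⟩ := IsNoetherian.noetherian (⊤ : Submodule R J)
  choose N hN using fun x : J => htor (g x)
  refine ⟨s.sup N, fun x => ?_⟩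
  have hx : x ∈ Submodule.span R (s : Set J) := hs ▸ Submodule.mem_top
  induction hx using Submodule.span_induction with
  | mem y hy =>
    exact fun a ha => hN y a (Ideal.pow_le_pow_right (Finset.le_sup (f := N) hy) ha)
  | zero => intro a _; rw [map_zero, smul_zero]
  | add y z _ _ hy hz => intro a ha; rw [map_add, smul_add, hy a ha, hz a ha, add_zero]
  | smul r y _ hy => intro a ha; rw [map_smul, smul_comm, hy a ha, smul_zero]

/-- Baer's criterion for `I`-power torsion modules over noetherian rings: it suffices to extend
maps from ideals which contain a power of `I`. -/
lemma injective_of_powerTorsion [IsNoetherianRing R] (I : Ideal R) (M : ModuleCat.{u} R)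
    (htor : ∀ x : M, x ∈ powerTorsion I M)
    (hext : ∀ (J : Ideal R) (n : ℕ), I ^ n ≤ J → ∀ g : J →ₗ[R] M,
      ∃ g' : R →ₗ[R] M, ∀ (x : R) (hx : x ∈ J), g' x = g ⟨x, hx⟩) : Injective M := by
  rw [← Module.injective_iff_injective_object]
  refine Module.Baer.injective fun J g => ?_
  obtain ⟨n, hn⟩ := exists_pow_smul_eq_zero I M htor J g
  -- Artin–Rees: `J ∩ I^(n+k)` lies in `I^n J`, where `g` vanishes. So `g` extends by zero to `J +
  -- I^(n+k)`, an ideal containing a power of `I`.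
  obtain ⟨k, hk⟩ := Ideal.exists_pow_inf_eq_pow_smul I (M := R) J
  have hker (x : R) (hx : x ∈ J) (hx' : x ∈ I ^ (n + k)) : g ⟨x, hx⟩ = 0 := by
    have h : x ∈ I ^ (n + k) • (⊤ : Submodule R R) ⊓ J :=
      ⟨by rwa [Ideal.smul_eq_mul, Ideal.mul_top], hx⟩
    rw [hk (n + k) (by lia), Nat.add_sub_cancel] at h
    have h' : x ∈ I ^ n • J := Submodule.smul_mono le_rfl inf_le_right h
    obtain ⟨_, h₀⟩ : ∃ hx : x ∈ J, g ⟨x, hx⟩ = 0 := by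
      refine Submodule.smul_induction_on (p := fun y => ∃ hy : y ∈ J, g ⟨y, hy⟩ = 0) h' ?_ ?_
      · intro a ha b hb
        exact ⟨J.smul_mem a hb, (map_smul g a ⟨b, hb⟩).trans (hn _ a ha)⟩
      · rintro y z ⟨hy, hy'⟩ ⟨hz, hz'⟩
        refine ⟨J.add_mem hy hz, (map_add g ⟨y, hy⟩ ⟨z, hz⟩).trans ?_⟩
        rw [hy', hz', add_zero]
    exact h₀
  let g₁ : R →ₗ.[R] M := ⟨J, g⟩
  let g₂ : R →ₗ.[R] M := ⟨I ^ (n + k), 0⟩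
  have hg : ∀ (x : g₁.domain) (y : g₂.domain), (x : R) = y → g₁ x = g₂ y := by
    rintro ⟨x, hx⟩ ⟨y, hy⟩ rfl
    exact hker x hx hy
  obtain ⟨g', hg'⟩ := hext (J ⊔ I ^ (n + k)) (n + k) le_sup_right (g₁.sup g₂ hg).toFun
  refine ⟨g', fun x hx => ?_⟩
  rw [hg' x (Submodule.mem_sup_left hx)]
  exact ((g₁.left_le_sup g₂ hg).2 (x := ⟨x, hx⟩) rfl).symm

lemma powerTorsion_restrict (I : Ideal R) (M : ModuleCat.{u} R) (x : (torsionFunctor I).obj M) :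
    x ∈ powerTorsion I ((torsionFunctor I).obj M) := by
  obtain ⟨n, hn⟩ := x.2
  exact ⟨n, fun a ha => Subtype.ext (hn a ha)⟩

/-- Over a noetherian ring, the torsion submodule of an injective module is injective. -/
lemma injective_torsionFunctor_obj [IsNoetherianRing R] (I : Ideal R) (M : ModuleCat.{u} R)
    [hM : Injective M] : Injective ((torsionFunctor I).obj M) := by
  refine injective_of_powerTorsion I _ (powerTorsion_restrict I M) fun J n hJ g => ?_
  rw [← Module.injective_iff_injective_object, ← Module.Baer.iff_injective] at hM
  obtain ⟨h, hh⟩ := hM J ((powerTorsion I M).subtype ∘ₗ g)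
  obtain ⟨c, hc⟩ := exists_pow_smul_eq_zero I _ (powerTorsion_restrict I M) J g
  -- The extension `h` has torsion values: `I^n` lies in `J`, where `h` agrees with `g`, and `I^c`
  -- kills the values of `g`.
  have hmem (r : R) : h r ∈ powerTorsion I M := by
    refine ⟨c + n, fun a ha => ?_⟩
    rw [← map_smul, smul_eq_mul]
    rw [pow_add] at ha
    refine Submodule.mul_induction_on ha (fun x hx y hy => ?_) (fun x y hx hy => ?_)
    · rw [mul_assoc, ← smul_eq_mul x, map_smul, hh _ (J.mul_mem_right r (hJ hy))]
      exact congrArg Subtype.val (hc _ x hx)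
    · rw [add_mul, map_add, hx, hy, add_zero]
  exact ⟨h.codRestrict _ hmem, fun x hx => Subtype.ext (hh x hx)⟩

end TorsionInjective

/-! ### Splitting of exact bounded below complexes of injectives. -/

section

variable {R : Type u} [CommRing R]

/-- Exactness in degree `i - 1` embeds the cokernel `opcycles (i - 1)` in `T^i`. That cokernel is
injective by induction from the bottom, so the embedding splits and `opcycles i` is a direct summand
of `T^i`. -/
lemma injective_opcycles (T : CochainComplex (ModuleCat.{u} R) ℤ) (s a : ℤ)
    [hT : ∀ i, Injective (T.X i)] (ha : ∀ i < a, IsZero (T.X i)) (hex : ∀ i < s, T.ExactAt i)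
    (i : ℤ) (hi : i ≤ s) : Injective (T.opcycles i) := by
  obtain ⟨n, hn⟩ : ∃ n : ℕ, i < a + n := ⟨(i - a + 1).toNat, by lia⟩
  induction n generalizing i with
  | zero =>
    have h0 : IsZero (T.opcycles i) := IsZero.of_epi (T.pOpcycles i) (ha i (by lia))
    exact Injective.of_iso h0.isoZero.symm inferInstance
  | succ n ih =>
    have hj := ih (i - 1) (by lia) (by push_cast at hn; lia)
    have hmono : Mono (T.fromOpcycles (i - 1) i) := by
      have h := hex (i - 1) (by lia)
      rw [T.exactAt_iff' (i - 1 - 1) (i - 1) i (by simp) (by simp)] at h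
      have := h.mono_fromOpcycles
      rw [(Iso.inv_comp_eq _).1
        (T.opcyclesIsoSc'_inv_fromOpcycles (i - 1 - 1) (i - 1) i (by simp) (by simp))]
      exact @mono_comp _ _ _ _ _ _ inferInstance _ this
    let r : T.X i ⟶ T.opcycles (i - 1) := Injective.factorThru (𝟙 _) (T.fromOpcycles (i - 1) i)
    have hr : T.fromOpcycles (i - 1) i ≫ r = 𝟙 _ := Injective.comp_factorThru _ _
    have h0 : T.fromOpcycles (i - 1) i ≫ T.pOpcycles i = 0 := by
      rw [← cancel_epi (T.pOpcycles (i - 1)), T.p_fromOpcycles_assoc, T.d_pOpcycles, comp_zero]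
    have h1 : T.d (i - 1) i ≫ (𝟙 _ - r ≫ T.fromOpcycles (i - 1) i) = 0 := by
      rw [Preadditive.comp_sub, Category.comp_id, ← T.p_fromOpcycles, Category.assoc,
        reassoc_of% hr, sub_self]
    refine Retract.injective (Y := T.X i) ⟨T.descOpcycles _ (i - 1) (by simp) h1,
      T.pOpcycles i, ?_⟩
    rw [← cancel_epi (T.pOpcycles i), T.p_descOpcycles_assoc, Preadditive.sub_comp,
      Category.assoc, h0, comp_zero, sub_zero, Category.comp_id, Category.id_comp]

end

/-! ### The complex `Γ_𝔪 D` and its one possibly nonzero cohomology module. -/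

section TorsionComplex

open IsLocalRing CochainComplex

variable {R : Type u} [CommRing R] [IsLocalRing R]

/-- The complex `Γ_𝔪 D`, reindexed so that its term of degree `i` is `Γ_𝔪 (D^{d+i})`. -/
def torsionComplex (D : CochainComplex (ModuleCat.{u} R) ℤ) (d : ℤ) :
    CochainComplex (ModuleCat.{u} R) ℤ where
  X i := (mTorsion R).obj (D.X (d + i))
  d i j := (mTorsion R).map (D.d (d + i) (d + j))
  shape i j hij := by
    rw [D.shape _ _ (fun h => hij (by simp at h ⊢; lia)), Functor.map_zero]
  d_comp_d' i j k _ _ := by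
    rw [← Functor.map_comp, D.d_comp_d, Functor.map_zero]

/-- The inclusion of `Γ_𝔪 (D^{d+i})` in `D^{d+i}`. -/
def torsionι (D : CochainComplex (ModuleCat.{u} R) ℤ) (d i : ℤ) :
    (torsionComplex D d).X i ⟶ D.X (d + i) :=
  torsionIncl (maximalIdeal R) (D.X (d + i))

instance (D : CochainComplex (ModuleCat.{u} R) ℤ) (d i : ℤ) : Mono (torsionι D d i) :=
  inferInstanceAs (Mono (torsionIncl (maximalIdeal R) (D.X (d + i))))

lemma torsionComplex_d_torsionι (D : CochainComplex (ModuleCat.{u} R) ℤ) (d i j : ℤ) :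
    (torsionComplex D d).d i j ≫ torsionι D d j = torsionι D d i ≫ D.d (d + i) (d + j) := rfl

lemma exists_lift_torsion {M X : ModuleCat.{u} R} (f : M ⟶ X)
    (hM : ∀ x : M, x ∈ powerTorsion (maximalIdeal R) M) :
    ∃ g : M ⟶ (mTorsion R).obj X, g ≫ torsionIncl (maximalIdeal R) X = f :=
  ⟨ModuleCat.ofHom (f.hom.codRestrict _ fun x => map_mem_powerTorsion _ f (hM x)), rfl⟩

lemma mem_powerTorsion_quotient (I : Ideal R) (n : ℕ) (hn : maximalIdeal R ^ n ≤ I)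
    (x : ModuleCat.of R (R ⧸ I)) : x ∈ powerTorsion (maximalIdeal R) (ModuleCat.of R (R ⧸ I)) := by
  refine ⟨n, fun a ha => ?_⟩
  obtain ⟨r, rfl⟩ := I.mkQ_surjective x
  change a • I.mkQ r = 0
  rw [← map_smul]
  exact (Submodule.Quotient.mk_eq_zero I).2 (I.mul_mem_right r (hn ha))

variable {D : CochainComplex (ModuleCat.{u} R) ℤ} (d : ℤ)

lemma HomExactAt.torsionComplex {M : ModuleCat.{u} R} {i : ℤ} (h : HomExactAt D M (d + i))
    (hM : ∀ x : M, x ∈ powerTorsion (maximalIdeal R) M) :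
    HomExactAt (torsionComplex D d) M i := by
  intro φ hφ
  obtain ⟨ψ, hψ⟩ := h.exists_comp_eq (l := d + (i - 1)) (m := d + (i + 1)) (by lia) (by lia)
    (φ ≫ torsionι D d i) (by
      rw [Category.assoc, ← torsionComplex_d_torsionι, reassoc_of% hφ, zero_comp])
  obtain ⟨ψ', hψ'⟩ : ∃ ψ' : M ⟶ (LocalCoh.torsionComplex D d).X (i - 1),
    ψ' ≫ torsionι D d (i - 1) = ψ := exists_lift_torsion ψ hM
  refine ⟨ψ', ?_⟩
  rw [← cancel_mono (torsionι D d i), ← hψ, ← hψ', Category.assoc, Category.assoc,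
    torsionComplex_d_torsionι]

/-- A complex of torsion modules is exact where the complexes `Hom_R(R/𝔪^n, -)` are. -/
lemma exactAt_of_homExactAt (T : CochainComplex (ModuleCat.{u} R) ℤ) (i : ℤ)
    (htor : ∀ x : T.X i, x ∈ powerTorsion (maximalIdeal R) (T.X i))
    (h : ∀ n, HomExactAt T (quotPow R n) i) : T.ExactAt i := by
  rw [exactAt_iff_forall (i - 1) i (i + 1) (by lia) rfl]
  intro x hx
  obtain ⟨n, hn⟩ := htor x
  obtain ⟨g, hg⟩ := exists_toQuotPow_comp_eq x n
    (fun a ha => hn a (Ideal.pow_le_pow_right n.le_succ ha))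
  obtain ⟨ψ, hψ⟩ := h n g (by
    rw [← cancel_epi (toQuotPow R n), comp_zero, ← Category.assoc]
    ext1
    refine LinearMap.ext_ring ?_
    change (T.d i (i + 1)).hom ((toQuotPow R n ≫ g).hom 1) = 0
    rw [hg, hx])
  refine ⟨(toQuotPow R n ≫ ψ).hom (1 : R), ?_⟩
  rw [← hg, ← hψ]
  rfl

/-- The only cohomology module of a bounded below complex `T` of injective torsion modules is
injective, when the complexes `Hom_R(R/J, T)` are exact outside one degree. -/
lemma injective_homology (T : CochainComplex (ModuleCat.{u} R) ℤ) (s a : ℤ)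
    [IsNoetherianRing R]
    [hT : ∀ i, Injective (T.X i)] (ha : ∀ i < a, IsZero (T.X i))
    (htor : ∀ i, ∀ x : T.X i, x ∈ powerTorsion (maximalIdeal R) (T.X i))
    (h : ∀ i ≠ s, ∀ (J : Ideal R) (n : ℕ), maximalIdeal R ^ n ≤ J →
      HomExactAt T (ModuleCat.of R (R ⧸ J)) i) :
    Injective (T.homology s) := by
  have hex (i : ℤ) (hi : i ≠ s) : T.ExactAt i :=
    exactAt_of_homExactAt T i (htor i) fun n => h i hi _ (n + 1) le_rfl
  have hop : Injective (T.opcycles s) :=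
    injective_opcycles T s a ha (fun i hi => hex i hi.ne) s le_rfl
  refine injective_of_powerTorsion (maximalIdeal R) _ ?_ fun J n hJ g => ?_
  · intro x
    obtain ⟨c, rfl⟩ := homologyπ_surjective T s x
    obtain ⟨n, hn⟩ := htor s ((T.iCycles s).hom c)
    have hc : c ∈ powerTorsion (maximalIdeal R) (T.cycles s) := ⟨n, fun r hr => by
      apply iCycles_injective
      rw [map_smul, hn r hr, map_zero]⟩
    exact map_mem_powerTorsion _ (T.homologyπ s) hc
  · let ι : ModuleCat.of R J ⟶ ModuleCat.of R R := ModuleCat.ofHom J.subtype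
    have hι : Mono ι := (ModuleCat.mono_iff_injective _).2 Subtype.val_injective
    let q : ModuleCat.of R R ⟶ ModuleCat.of R (R ⧸ J) := ModuleCat.ofHom J.mkQ
    have hιq : ι ≫ q = 0 := by
      ext x : 2
      exact (Submodule.Quotient.mk_eq_zero J).2 x.2
    have hq : (ShortComplex.mk ι q hιq).ShortExact := by
      apply ModuleCat.shortComplex_shortExact
      · intro x
        exact ⟨fun hx => ⟨⟨x, (Submodule.Quotient.mk_eq_zero J).1 hx⟩, rfl⟩,
          by rintro ⟨x, rfl⟩; exact (Submodule.Quotient.mk_eq_zero J).2 x.2⟩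
      · exact Subtype.val_injective
      · exact J.mkQ_surjective
    have := hq.epi_g
    let g₁ : ModuleCat.of R J ⟶ T.homology s := ModuleCat.ofHom g
    -- The extension `g₂` takes values in `opcycles s`, which contains `H^s`. Its image in `T^(s+1)`
    -- vanishes on `J`, so it is a cocycle `R/J ⟶ T^(s+1)`. Exactness in degree `s + 1` gives a
    -- primitive `ψ`, and subtracting `ψ` brings `g₂` into `H^s` without changing it on `J`.
    let g₂ : ModuleCat.of R R ⟶ T.opcycles s := Injective.factorThru (g₁ ≫ T.homologyι s) ι
    have hg₂ : ι ≫ g₂ = g₁ ≫ T.homologyι s := Injective.comp_factorThru _ _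
    have h0 : ι ≫ g₂ ≫ T.fromOpcycles s (s + 1) = 0 := by
      rw [reassoc_of% hg₂, T.homologyι_comp_fromOpcycles, comp_zero]
    obtain ⟨ψ, hψ⟩ := (h (s + 1) (by lia) J n hJ).exists_comp_eq (l := s) rfl rfl
      (hq.exact.desc _ h0) (by
        rw [← cancel_epi q]
        rw [comp_zero, ← Category.assoc, hq.exact.g_desc]
        simp)
    let g₃ := g₂ - q ≫ ψ ≫ T.pOpcycles s
    have hg₃ : g₃ ≫ T.fromOpcycles s (s + 1) = 0 := by
      dsimp only [g₃]
      rw [Preadditive.sub_comp, Category.assoc, Category.assoc, T.p_fromOpcycles, hψ,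
        hq.exact.g_desc, sub_self]
    let g₄ : ModuleCat.of R R ⟶ T.homology s :=
      (T.homologyIsKernel s (s + 1) (by simp)).lift (KernelFork.ofι _ hg₃)
    have hg₄ : g₄ ≫ T.homologyι s = g₃ :=
      (T.homologyIsKernel s (s + 1) (by simp)).fac _ WalkingParallelPair.zero
    have hg₅ : ι ≫ g₄ = g₁ := by
      rw [← cancel_mono (T.homologyι s), Category.assoc, hg₄]
      dsimp only [g₃]
      rw [Preadditive.comp_sub, reassoc_of% hιq, zero_comp, sub_zero, hg₂]
    exact ⟨g₄.hom, fun x hx => congrArg (fun f => f.hom ⟨x, hx⟩) hg₅⟩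

/-- The complex `Γ_𝔪 D`, for a dualizing complex `D`, has only one nonzero cohomology module,
which is injective. -/
lemma exists_torsionComplex_homology [IsNoetherianRing R] (hD : IsDualizingComplex D) :
    ∃ s : ℤ, Injective ((torsionComplex D d).homology s) ∧
      ∀ i ≠ s, (torsionComplex D d).ExactAt i := by
  have := hD.injective
  have := quasiIso_evalDual_sg hD (resField R)
  obtain ⟨t, ht⟩ := exists_homExactAt_resField (D := D)
  obtain ⟨a, b, hab⟩ := hD.bounded
  have htor (i : ℤ) (x : (torsionComplex D d).X i) :
      x ∈ powerTorsion (maximalIdeal R) ((torsionComplex D d).X i) :=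
    powerTorsion_restrict _ _ x
  have h (i : ℤ) (hi : i ≠ t - d) (J : Ideal R) (n : ℕ) (hJ : maximalIdeal R ^ n ≤ J) :
      HomExactAt (torsionComplex D d) (ModuleCat.of R (R ⧸ J)) i :=
    ((ht (d + i) (by lia)).quotient J n hJ).torsionComplex d (mem_powerTorsion_quotient J n hJ)
  have (i : ℤ) : Injective ((torsionComplex D d).X i) :=
    injective_torsionFunctor_obj (maximalIdeal R) (D.X (d + i))
  refine ⟨t - d, injective_homology _ (t - d) (a - d) ?_ htor h, fun i hi =>
    exactAt_of_homExactAt _ i (htor i) fun n => h i hi _ (n + 1) le_rfl⟩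
  intro i hi
  exact IsZero.of_mono (torsionι D d i) (hab _ (Or.inl (by lia)))

end TorsionComplex

/-! ### Derived maps into a complex whose only cohomology is an injective module. -/

section Vanishing

open DerivedCategory CochainComplex CochainComplex.HomComplex

universe w

variable {R : Type u} [CommRing R]

/-- The target has zero differential, so `f` vanishes on the cycles of degree `s` and factors
through the image of `d` in `X^(s+1)`. Injectivity of `E` extends it to `X^(s+1)`, and the extension
is the homotopy. -/
lemma exists_δ_eq_of_homologyMap_eq_zero (X : CochainComplex (ModuleCat.{u} R) ℤ) (s : ℤ)
    (E : ModuleCat.{u} R) [Injective E] (f : X ⟶ sg s E)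
    (hf : HomologicalComplex.homologyMap f s = 0) :
    ∃ z : Cochain X (sg s E) (-1), δ (-1) 0 z = Cochain.ofHom f := by
  have hE : Injective ((sg s E).X s) :=
    Injective.of_iso (HomologicalComplex.singleObjXSelf (.up ℤ) s E).symm inferInstance
  have h0 : X.iCycles s ≫ f.f s = 0 := by
    ext c
    have h := homologyMap_homologyπ f s c
    rw [hf] at h
    obtain ⟨y, hy⟩ := (homologyπ_eq_zero_iff (s - 1) s (by lia) _).1 h.symm
    rw [sg_d, iCycles_cyclesMap] at hy
    exact hy.symm
  have hex : (ShortComplex.mk (X.iCycles s) (X.d s (s + 1)) (by simp)).Exact :=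
    ShortComplex.exact_of_f_is_kernel _ (X.cyclesIsKernel s (s + 1) (by simp))
  let h : X.X (s + 1) ⟶ (sg s E).X s := hex.descToInjective (f.f s) h0
  have hh : X.d s (s + 1) ≫ h = f.f s := hex.comp_descToInjective _ _
  refine ⟨Cochain.single h (-1), ?_⟩
  rw [Cochain.δ_single h (-1) 0 (by lia) s (s + 1) rfl rfl, sg_d, comp_zero, hh,
    Int.negOnePow_zero, one_smul]
  ext1 p
  by_cases hp : p = s
  · subst hp
    simp
  · exact (isZero_sg_X s E p hp).eq_of_tgt _ _

variable [HasDerivedCategory.{w} (ModuleCat.{u} R)]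

lemma exists_Q_map_eq_of_isKInjective {X L : CochainComplex (ModuleCat.{u} R) ℤ} [L.IsKInjective]
    (f : Q.obj X ⟶ Q.obj L) : ∃ g : X ⟶ L, Q.map g = f := by
  obtain ⟨g, hg⟩ := (IsKInjective.Qh_map_bijective _ L).2
    ((quotientCompQhIso _).hom.app X ≫ f ≫ (quotientCompQhIso _).inv.app L)
  obtain ⟨g, rfl⟩ := (HomotopyCategory.quotient _ _).map_surjective g
  refine ⟨g, ?_⟩
  rw [← cancel_epi ((quotientCompQhIso _).hom.app X), ← quotientCompQhIso_hom_naturality, hg]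
  simp

lemma exists_Q_map_eq_of_isKProjective {X L : CochainComplex (ModuleCat.{u} R) ℤ}
    [X.IsKProjective] (f : Q.obj X ⟶ Q.obj L) : ∃ g : X ⟶ L, Q.map g = f := by
  obtain ⟨g, hg⟩ := (IsKProjective.Qh_map_bijective X _).2
    ((quotientCompQhIso _).hom.app X ≫ f ≫ (quotientCompQhIso _).inv.app L)
  obtain ⟨g, rfl⟩ := (HomotopyCategory.quotient _ _).map_surjective g
  refine ⟨g, ?_⟩
  rw [← cancel_epi ((quotientCompQhIso _).hom.app X), ← quotientCompQhIso_hom_naturality, hg]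
  simp

/-- In the derived category `T` is an injective module placed in degree `s`, which is K-injective.
So `f` is represented by a chain map, and that map is null-homotopic. -/
lemma eq_zero_of_homologyFunctor_map_eq_zero (X T : CochainComplex (ModuleCat.{u} R) ℤ) (s : ℤ)
    (hE : Injective (T.homology s)) (hT : ∀ i ≠ s, T.ExactAt i) (f : Q.obj X ⟶ Q.obj T)
    (hf : (homologyFunctor (ModuleCat.{u} R) s).map f = 0) : f = 0 := by
  have : T.IsGE s := by
    rw [CochainComplex.isGE_iff]
    exact fun i hi => hT i hi.ne
  have : T.IsLE s := by
    rw [CochainComplex.isLE_iff]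
    exact fun i hi => hT i hi.ne'
  obtain ⟨E, ⟨e⟩⟩ := exists_iso_singleFunctor_obj_of_isGE_of_isLE (Q.obj T) s
  have : Injective E :=
    Injective.of_iso (((homologyFunctorFactors _ s).app T).symm ≪≫
      (homologyFunctor _ s).mapIso e ≪≫ (singleFunctorCompHomologyFunctorIso _ s).app E) hE
  let e' : Q.obj T ≅ Q.obj (sg s E) := e ≪≫ (singleFunctorIsoCompQ _ s).app E
  have : (sg s E).IsKInjective := by
    have (i : ℤ) : Injective ((sg s E).X i) := by
      by_cases hi : i = s
      · subst hi
        exact Injective.of_iso (HomologicalComplex.singleObjXSelf (.up ℤ) i E).symm inferInstance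
      · exact Injective.of_iso (isZero_sg_X s E i hi).isoZero.symm inferInstance
    exact isKInjective_of_injective _ s
  obtain ⟨g, hg⟩ : ∃ g : X ⟶ sg s E, Q.map g = f ≫ e'.hom :=
    exists_Q_map_eq_of_isKInjective _
  have hg₀ : HomologicalComplex.homologyMap g s = 0 := by
    refine (cancel_epi ((homologyFunctorFactors _ s).hom.app X)).1 ?_
    refine (homologyFunctorFactors_hom_naturality g s).symm.trans ?_
    rw [hg, Functor.map_comp, hf, zero_comp, zero_comp]
    exact comp_zero.symm
  obtain ⟨z, hz⟩ := exists_δ_eq_of_homologyMap_eq_zero X s E g hg₀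
  have : Q.map g = 0 := by
    rw [← Q.map_zero]
    exact Q_map_eq_of_homotopy _ ((Cochain.equivHomotopy _ _).symm ⟨z, by
      rw [hz, Cochain.ofHom_zero, add_zero]⟩)
  rw [← cancel_mono e'.hom, zero_comp, ← hg, this]

end Vanishing

/-! ### Direct systems `G` with `colim Hom(Y, G_n) = 0` for bounded `Y` with finitely generated
cohomology. -/

section Effaceable

open DerivedCategory CochainComplex Pretriangulated

universe w

variable {R : Type u} [CommRing R] [HasDerivedCategory.{w} (ModuleCat.{u} R)]
  (G : ℕ ⥤ CochainComplex (ModuleCat.{u} R) ℤ)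

/-- Every map in the derived category from `Y` to a term of the direct system `G` vanishes in a
further term. -/
def IsEffaced (Y : DerivedCategory (ModuleCat.{u} R)) : Prop :=
  ∀ (n : ℕ) (f : Y ⟶ Q.obj (G.obj n)), ∃ (m : ℕ) (h : n ⟶ m), f ≫ Q.map (G.map h) = 0

variable {G}

lemma IsEffaced.of_iso {Y Z : DerivedCategory (ModuleCat.{u} R)} (hY : IsEffaced G Y) (e : Y ≅ Z) :
    IsEffaced G Z := by
  intro n f
  obtain ⟨m, h, hf⟩ := hY n (e.hom ≫ f)
  exact ⟨m, h, by rwa [Category.assoc, Preadditive.IsIso.comp_left_eq_zero] at hf⟩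

lemma IsEffaced.of_distinguished (T : Triangle (DerivedCategory (ModuleCat.{u} R)))
    (hT : T ∈ distTriang _) (h₁ : IsEffaced G T.obj₁) (h₃ : IsEffaced G T.obj₃) :
    IsEffaced G T.obj₂ := by
  intro n f
  obtain ⟨m, h, hf⟩ := h₁ n (T.mor₁ ≫ f)
  rw [Category.assoc] at hf
  obtain ⟨g, hg⟩ := Triangle.yoneda_exact₂ T hT _ hf
  obtain ⟨l, h', hg'⟩ := h₃ m g
  refine ⟨l, h ≫ h', ?_⟩
  rw [G.map_comp, Q.map_comp, reassoc_of% hg, hg', comp_zero]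

lemma IsEffaced.of_isZero {Y : DerivedCategory (ModuleCat.{u} R)} (hY : IsZero Y) :
    IsEffaced G Y := fun n _ => ⟨n, 𝟙 n, hY.eq_of_src _ _⟩

/-- A free module in one degree is K-projective, so a derived map from it is a chain map and is
determined by the image of 1, an element that dies further on. -/
lemma isEffaced_sg_one
    (hG : ∀ (n : ℕ) (p : ℤ) (x : (G.obj n).X p), ∃ (m : ℕ) (h : n ⟶ m),
      ((G.map h).f p).hom x = 0) (p : ℤ) : IsEffaced G (Q.obj (sg p (ModuleCat.of R R))) := by
  intro n f
  have : (sg p (ModuleCat.of R R)).IsKProjective := by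
    have (i : ℤ) : Projective ((sg p (ModuleCat.of R R)).X i) := by
      by_cases hi : i = p
      · subst hi
        exact Projective.of_iso (HomologicalComplex.singleObjXSelf (.up ℤ) i _).symm
          (ModuleCat.projective_of_free (Module.Basis.singleton Unit R))
      · exact Projective.of_iso (isZero_sg_X p _ i hi).isoZero.symm inferInstance
    exact isKProjective_of_projective _ p
  obtain ⟨g, rfl⟩ := exists_Q_map_eq_of_isKProjective f
  obtain ⟨m, h, hx⟩ := hG n p ((g.f p).hom (sgElt p (1 : ModuleCat.of R R)))
  refine ⟨m, h, ?_⟩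
  rw [← Q.map_comp]
  have h0 : g ≫ G.map h = 0 := by
    ext i x
    by_cases hi : i = p
    · subst hi
      obtain ⟨r, rfl⟩ := sgElt_surjective i x
      have hr : sgElt i (r : ModuleCat.of R R) = r • sgElt i (1 : ModuleCat.of R R) := by
        rw [← sgElt_smul]
        congr 1
        exact (mul_one r).symm
      rw [hr, map_smul, map_smul]
      exact (congrArg (r • ·) hx).trans ((smul_zero r).trans (smul_zero r).symm)
    · rw [@Subsingleton.elim _ (ModuleCat.subsingleton_of_isZero (isZero_sg_X p _ i hi)) x 0,
        map_zero, map_zero]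
  rw [h0, Q.map_zero]

/-- The lower bound `a`, uniform in `n`, leaves no nonzero maps from degree `p < a`. In a
presentation, the rotated triangle places `X₃` between `X₂` in degree `p` and the shift of `X₁`,
which is `X₁` in degree `p - 1`. -/
lemma isEffaced_sg [IsNoetherianRing R]
    (hG : ∀ (n : ℕ) (p : ℤ) (x : (G.obj n).X p), ∃ (m : ℕ) (h : n ⟶ m),
      ((G.map h).f p).hom x = 0)
    (a : ℤ) (ha : ∀ n, (G.obj n).IsStrictlyGE a) (p : ℤ) (M : ModuleCat.{u} R) [Module.Finite R M] :
    IsEffaced G (Q.obj (sg p M)) := by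
  refine fg_induction (fun p M => IsEffaced G (Q.obj (sg p M))) a ?_ ?_ ?_ p M
  · intro p hp M n f
    have := ha n
    have : (Q.obj (sg p M)).IsLE p :=
      inferInstanceAs (((DerivedCategory.singleFunctor _ p).obj M).IsLE p)
    exact ⟨n, 𝟙 n, by rw [TStructure.t.zero f p a hp, zero_comp]⟩
  · intro p s
    refine free_induction (fun M => IsEffaced G (Q.obj (sg p M))) ?_ (isEffaced_sg_one hG p) ?_ s
    · intro M hM
      exact IsEffaced.of_isZero (Functor.map_isZero (DerivedCategory.singleFunctor _ p) hM)
    · intro S hS h₁ h₃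
      exact IsEffaced.of_distinguished _ (triangleOfSES_distinguished (sg_shortExact p S hS)) h₁ h₃
  · intro p S hS h₂ h₁
    exact IsEffaced.of_distinguished _ (rot_of_distTriang _
      (triangleOfSES_distinguished (sg_shortExact p S hS))) h₂
      (h₁.of_iso (((DerivedCategory.singleFunctors _).shiftIso 1 (p - 1) p (by lia)).app S.X₁).symm)

/-- Maps from a bounded complex with finitely generated cohomology into the direct system `G`
are effaced. -/
theorem isEffaced_of_bounded [IsNoetherianRing R]
    (hG : ∀ (n : ℕ) (p : ℤ) (x : (G.obj n).X p), ∃ (m : ℕ) (h : n ⟶ m),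
      ((G.map h).f p).hom x = 0)
    (a : ℤ) (ha : ∀ n, (G.obj n).IsStrictlyGE a) (Y : DerivedCategory (ModuleCat.{u} R)) (b c : ℤ)
    (hY : ∀ i, i < b ∨ c < i → IsZero ((homologyFunctor (ModuleCat.{u} R) i).obj Y))
    (hfin : ∀ i, Module.Finite R ((homologyFunctor (ModuleCat.{u} R) i).obj Y)) : IsEffaced G Y := by
  obtain ⟨n, hn⟩ : ∃ n : ℕ, c ≤ b + n := ⟨(c - b).toNat, by lia⟩
  induction n generalizing Y b with
  | zero =>
    have : Y.IsGE b := (DerivedCategory.isGE_iff _ _).2 fun i hi => hY i (Or.inl hi)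
    have : Y.IsLE b := (DerivedCategory.isLE_iff _ _).2 fun i hi => hY i (Or.inr (by push_cast at hn; lia))
    obtain ⟨M, ⟨e⟩⟩ := exists_iso_singleFunctor_obj_of_isGE_of_isLE Y b
    have := hfin b
    have : Module.Finite R M := finite_of_iso
      ((homologyFunctor _ b).mapIso e ≪≫ (singleFunctorCompHomologyFunctorIso _ b).app M)
    exact (isEffaced_sg hG a ha b M).of_iso e.symm
  | succ n ih =>
    -- Truncation: `A` has cohomology only in degree `b` and is a shifted module, while `B` starts
    -- in degree `b + 1` and has shorter range. The long exact sequence keeps both finitely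
    -- generated.
    obtain ⟨A, B, hA, hB, f, g, h, hT⟩ := TStructure.t.exists_triangle Y b (b + 1) rfl
    have hA' : A.IsLE b := ⟨hA⟩
    have hB' : B.IsGE (b + 1) := ⟨hB⟩
    rw [DerivedCategory.isLE_iff] at hA'
    rw [DerivedCategory.isGE_iff] at hB'
    have hA₀ (i : ℤ) (hi : i < b) : IsZero ((homologyFunctor (ModuleCat.{u} R) i).obj A) :=
      (HomologySequence.exact₁ _ hT (i - 1) i (by lia)).isZero_X₂
        ((hB' (i - 1) (by lia)).eq_of_src _ _) ((hY i (Or.inl hi)).eq_of_tgt _ _)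
    have hB₀ (i : ℤ) (hi : max b c < i) : IsZero ((homologyFunctor (ModuleCat.{u} R) i).obj B) :=
      (HomologySequence.exact₃ _ hT i (i + 1) rfl).isZero_X₂
        ((hY i (Or.inr (by lia))).eq_of_src _ _) ((hA' (i + 1) (by lia)).eq_of_tgt _ _)
    have hAf (i : ℤ) : Module.Finite R ((homologyFunctor (ModuleCat.{u} R) i).obj A) := by
      by_cases hi : b < i
      · exact finite_of_isZero (hA' i hi)
      · exact @finite_of_exact R _ _ _ (HomologySequence.exact₁ _ hT (i - 1) i (by lia))
          (finite_of_isZero (hB' _ (by lia))) (hfin i)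
    have hBf (i : ℤ) : Module.Finite R ((homologyFunctor (ModuleCat.{u} R) i).obj B) := by
      by_cases hi : i < b
      · exact finite_of_isZero (hB' i (by lia))
      · exact @finite_of_exact R _ _ _ (HomologySequence.exact₃ _ hT i (i + 1) rfl)
          (hfin i) (finite_of_isZero (hA' _ (by lia)))
    refine IsEffaced.of_distinguished _ hT ?_ ?_
    · have : A.IsGE b := (DerivedCategory.isGE_iff _ _).2 hA₀
      have : A.IsLE b := (DerivedCategory.isLE_iff _ _).2 hA'
      obtain ⟨M, ⟨e⟩⟩ := exists_iso_singleFunctor_obj_of_isGE_of_isLE A b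
      have := hAf b
      have : Module.Finite R M := finite_of_iso
        ((homologyFunctor _ b).mapIso e ≪≫ (singleFunctorCompHomologyFunctorIso _ b).app M)
      exact (isEffaced_sg hG a ha b M).of_iso e.symm
    · refine ih B (b + 1) (fun i hi => ?_) hBf (by push_cast at hn; lia)
      rcases hi with hi | hi
      · exact hB' i hi
      · by_cases hib : i < b + 1
        · exact hB' i hib
        · exact hB₀ i (by lia)

end Effaceable

section

variable {R : Type u} [CommRing R]

lemma sg_map_sgElt (p : ℤ) {M N : ModuleCat.{u} R} (f : M ⟶ N) (x : M) :
    (((CochainComplex.singleFunctor (ModuleCat.{u} R) p).map f).f p).hom (sgElt p x) =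
      sgElt p (f.hom x) := by
  have h : (HomologicalComplex.singleObjXSelf (.up ℤ) p M).inv ≫
      ((CochainComplex.singleFunctor (ModuleCat.{u} R) p).map f).f p =
        f ≫ (HomologicalComplex.singleObjXSelf (.up ℤ) p N).inv := by
    change _ ≫ ((HomologicalComplex.single (ModuleCat.{u} R) (.up ℤ) p).map f).f p = _
    rw [HomologicalComplex.single_map_f_self, Iso.inv_hom_id_assoc]
  exact congrArg (fun g => g.hom x) h

end

/-! ### `Γ_𝔪 D` as the union of the complexes `Hom_R(R/𝔪^(n+1), D)`. -/

section TorsionQuotient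

open IsLocalRing CochainComplex CochainComplex.HomComplex DerivedCategory Pretriangulated

universe w

variable {R : Type u} [CommRing R] [IsLocalRing R] (D : CochainComplex (ModuleCat.{u} R) ℤ) (d : ℤ)

/-- The complex `Hom_R(R/𝔪^(n+1), D)`, shifted by `d`. -/
abbrev dualQuotPow (n : ℕ) : CochainComplex (ModuleCat.{u} R) ℤ := dual D (sg d (quotPow R n))

/-- The transition maps `Hom_R(R/𝔪^(n+1), D) ⟶ Hom_R(R/𝔪^(m+1), D)`. -/
def dualQuotPowMap {n m : ℕ} (h : n ≤ m) : dualQuotPow D d n ⟶ dualQuotPow D d m :=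
  dualMap D ((CochainComplex.singleFunctor (ModuleCat.{u} R) d).map (quotPowMap R h))

/-- The element `1` of `R/𝔪^(n+1)`. -/
def quotPowOne (n : ℕ) : quotPow R n := (toQuotPow R n).hom (1 : R)

lemma smul_quotPowOne (n : ℕ) (r : R) (hr : r ∈ maximalIdeal R ^ (n + 1)) :
    r • quotPowOne (R := R) n = 0 := by
  dsimp only [quotPowOne]
  rw [← map_smul, smul_eq_mul, mul_one]
  exact (Submodule.Quotient.mk_eq_zero _).2 hr

/-- The inclusion `Hom_R(R/𝔪^(n+1), D) ⟶ Γ_𝔪 D`, given by evaluation at `1`. -/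
def dualQuotPowToTorsion (n : ℕ) : dualQuotPow D d n ⟶ torsionComplex D d where
  f i := ModuleCat.ofHom ((evalAt D (rfl : d + i = d + i)
    (sgElt d (quotPowOne (R := R) n))).hom.codRestrict
      (powerTorsion (maximalIdeal R) (D.X (d + i))) fun φ => ⟨n + 1, fun r hr => by
        refine (map_smul (ModuleCat.Hom.hom (Cochain.v φ d (d + i) rfl)) r _).symm.trans ?_
        rw [← sgElt_smul, smul_quotPowOne n r hr]
        exact (congrArg _ (map_zero _)).trans (map_zero _)⟩)
  comm' i j hij := by
    ext1
    refine LinearMap.ext fun (φ : Cochain (sg d (quotPow R n)) D i) => Subtype.ext ?_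
    change (D.d (d + i) (d + j)).hom ((φ.v d (d + i) rfl).hom _) =
      ((δ i j φ).v d (d + j) rfl).hom _
    rw [δ_sg_v hij rfl]
    rfl

lemma dualQuotPowToTorsion_torsionι (n : ℕ) (i : ℤ) (φ : Cochain (sg d (quotPow R n)) D i) :
    (torsionι D d i).hom (((dualQuotPowToTorsion D d n).f i).hom φ) =
      (φ.v d (d + i) rfl).hom (sgElt d (quotPowOne (R := R) n)) := rfl

lemma torsionι_injective (i : ℤ) : Function.Injective (torsionι D d i).hom :=
  (ModuleCat.mono_iff_injective _).1 inferInstance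

lemma dualQuotPowMap_toTorsion {n m : ℕ} (h : n ≤ m) :
    dualQuotPowMap D d h ≫ dualQuotPowToTorsion D d m = dualQuotPowToTorsion D d n := by
  ext i : 2
  refine LinearMap.ext fun (φ : Cochain (sg d (quotPow R n)) D i) => ?_
  refine torsionι_injective D d i ?_
  change (Cochain.v (((dualMap D ((CochainComplex.singleFunctor (ModuleCat.{u} R) d).map
    (quotPowMap R h))).f i).hom φ : Cochain (sg d (quotPow R m)) D i) d (d + i) rfl).hom
      (sgElt d (quotPowOne (R := R) m)) = (φ.v d (d + i) rfl).hom (sgElt d (quotPowOne (R := R) n))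
  rw [dualMap_v]
  change (φ.v d (d + i) rfl).hom ((((CochainComplex.singleFunctor (ModuleCat.{u} R) d).map
    (quotPowMap R h)).f d).hom (sgElt d (quotPowOne (R := R) m))) = _
  rw [sg_map_sgElt]
  congr 2

/-- An element of `Γ_𝔪 D` killed by `𝔪^(n+1)` comes from `Hom_R(R/𝔪^(n+1), D)`. -/
lemma exists_dualQuotPowToTorsion_eq (n : ℕ) (i : ℤ) (x : (torsionComplex D d).X i)
    (hx : ∀ r ∈ maximalIdeal R ^ (n + 1), r • x = 0) :
    ∃ φ, ((dualQuotPowToTorsion D d n).f i).hom φ = x := by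
  obtain ⟨g, hg⟩ := exists_toQuotPow_comp_eq ((torsionι D d i).hom x) n
    (fun r hr => by rw [← map_smul, hx r hr, map_zero])
  refine ⟨(Cochain.fromSingleMk g rfl : Cochain (sg d (quotPow R n)) D i), ?_⟩
  refine torsionι_injective D d i ?_
  rw [dualQuotPowToTorsion_torsionι, Cochain.fromSingleMk_v, ← hg]
  have := congrArg (fun g => g.hom (quotPowOne (R := R) n))
    (HomologicalComplex.singleObjXSelf (.up ℤ) d (quotPow R n)).inv_hom_id
  exact congrArg g.hom this

instance (n : ℕ) : Mono (dualQuotPowToTorsion D d n) := by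
  have (i : ℤ) : Mono ((dualQuotPowToTorsion D d n).f i) := by
    rw [ModuleCat.mono_iff_injective]
    refine (injective_iff_map_eq_zero ((dualQuotPowToTorsion D d n).f i).hom).2 ?_
    intro (φ : Cochain (sg d (quotPow R n)) D i) hφ
    have h := congrArg (torsionι D d i).hom hφ
    rw [dualQuotPowToTorsion_torsionι, map_zero] at h
    suffices h' : φ = (0 : Cochain (sg d (quotPow R n)) D i) from h'
    refine (Cochain.fromSingleEquiv (rfl : d + i = d + i)).injective ?_
    rw [map_zero, ← cancel_epi (toQuotPow R n), comp_zero]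
    ext1
    exact LinearMap.ext_ring h
  exact HomologicalComplex.mono_of_mono_f _ this

/-- The direct system with terms `Γ_𝔪 D / Hom_R(R/𝔪^(n+1), D)`. -/
def torsionQuotient : ℕ ⥤ CochainComplex (ModuleCat.{u} R) ℤ where
  obj n := cokernel (dualQuotPowToTorsion D d n)
  map {n m} h := cokernel.desc _ (cokernel.π (dualQuotPowToTorsion D d m)) (by
    rw [← dualQuotPowMap_toTorsion D d (leOfHom h), Category.assoc, cokernel.condition,
      comp_zero])
  map_id n := by
    rw [← cancel_epi (cokernel.π _), cokernel.π_desc, Category.comp_id]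
  map_comp f g := by
    rw [← cancel_epi (cokernel.π _), cokernel.π_desc, cokernel.π_desc_assoc, cokernel.π_desc]

/-- The exact sequence `0 ⟶ Hom_R(R/𝔪^(n+1), D) ⟶ Γ_𝔪 D ⟶ C_n ⟶ 0`. -/
def torsionShortComplex (n : ℕ) : ShortComplex (CochainComplex (ModuleCat.{u} R) ℤ) :=
  ShortComplex.mk (X₃ := (torsionQuotient D d).obj n) (dualQuotPowToTorsion D d n)
    (cokernel.π (dualQuotPowToTorsion D d n)) (cokernel.condition _)

lemma torsionShortComplex_shortExact (n : ℕ) : (torsionShortComplex D d n).ShortExact where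
  exact := ShortComplex.exact_cokernel _
  mono_f := inferInstanceAs (Mono (dualQuotPowToTorsion D d n))
  epi_g := inferInstanceAs (Epi (cokernel.π (dualQuotPowToTorsion D d n)))

/-- The transition maps between the sequences `torsionShortComplex`. -/
def torsionShortComplexMap {n m : ℕ} (h : n ⟶ m) :
    torsionShortComplex D d n ⟶ torsionShortComplex D d m where
  τ₁ := dualQuotPowMap D d (leOfHom h)
  τ₂ := 𝟙 _
  τ₃ := (torsionQuotient D d).map h
  comm₁₂ := (dualQuotPowMap_toTorsion D d (leOfHom h)).trans (Category.comp_id _).symm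
  comm₂₃ := (Category.id_comp _).trans (cokernel.π_desc _ _ _).symm

lemma torsionShortComplex_g_surjective (n : ℕ) (p : ℤ) :
    Function.Surjective ((torsionShortComplex D d n).g.f p).hom := by
  have h := (HomologicalComplex.shortExact_iff_degreewise_shortExact _).1
    (torsionShortComplex_shortExact D d n) p
  exact (ModuleCat.epi_iff_surjective _).1 h.epi_g

/-- An element of `Γ_𝔪 D` is killed by a power of `𝔪`, hence lies in one of the subcomplexes being
divided out. -/
lemma torsionQuotient_map_eq_zero (n : ℕ) (p : ℤ) (x : ((torsionQuotient D d).obj n).X p) :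
    ∃ (m : ℕ) (h : n ⟶ m), (((torsionQuotient D d).map h).f p).hom x = 0 := by
  obtain ⟨y, rfl⟩ := torsionShortComplex_g_surjective D d n p x
  obtain ⟨m, hm⟩ := powerTorsion_restrict _ _ (show (mTorsion R).obj (D.X (d + p)) from y)
  obtain ⟨φ, hφ⟩ := exists_dualQuotPowToTorsion_eq D d (max n m) p y (fun r hr =>
    hm r (Ideal.pow_le_pow_right (by lia) hr))
  refine ⟨max n m, homOfLE (le_max_left n m), ?_⟩
  have h₁ := (torsionShortComplexMap D d (homOfLE (le_max_left n m))).comm₂₃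
  have h₂ := congrArg (fun f => (f.f p).hom y) h₁
  refine h₂.symm.trans ?_
  change ((torsionShortComplex D d (max n m)).g.f p).hom y = 0
  rw [← hφ]
  exact congrArg (fun f => (f.f p).hom φ) (torsionShortComplex D d (max n m)).zero

lemma isStrictlyGE_torsionQuotient (a : ℤ) (ha : ∀ i < a, IsZero (D.X i)) (n : ℕ) :
    ((torsionQuotient D d).obj n).IsStrictlyGE (a - d) := by
  rw [CochainComplex.isStrictlyGE_iff]
  intro i hi
  have h := (HomologicalComplex.shortExact_iff_degreewise_shortExact _).1
    (torsionShortComplex_shortExact D d n) i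
  have h₂ : IsZero ((torsionComplex D d).X i) :=
    IsZero.of_mono (torsionι D d i) (ha _ (by lia))
  exact @IsZero.of_epi _ _ _ _ _ _ h.epi_g h₂

variable {D} [HasDerivedCategory.{w} (ModuleCat.{u} R)]

/-- A map from a bounded complex with finitely generated cohomology to `Hom_R(R/𝔪^(n+1), D)`
which vanishes in `Γ_𝔪 D` vanishes in some `Hom_R(R/𝔪^(m+1), D)`. -/
theorem exists_comp_dualQuotPowMap_eq_zero [IsNoetherianRing R] (hD : IsDualizingComplex D)
    (Y : DerivedCategory (ModuleCat.{u} R)) (b c : ℤ)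
    (hY : ∀ i, i < b ∨ c < i → IsZero ((homologyFunctor (ModuleCat.{u} R) i).obj Y))
    (hfin : ∀ i, Module.Finite R ((homologyFunctor (ModuleCat.{u} R) i).obj Y)) (n : ℕ)
    (f : Y ⟶ Q.obj (dualQuotPow D d n)) (hf : f ≫ Q.map (dualQuotPowToTorsion D d n) = 0) :
    ∃ (m : ℕ) (h : n ≤ m), f ≫ Q.map (dualQuotPowMap D d h) = 0 := by
  obtain ⟨a, _, ha⟩ := hD.bounded
  let e (i : ℤ) : (homologyFunctor (ModuleCat.{u} R) i).obj (Y⟦(1 : ℤ)⟧) ≅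
      (homologyFunctor (ModuleCat.{u} R) (i + 1)).obj Y :=
    ((homologyFunctor (ModuleCat.{u} R) 0).shiftIso 1 i (i + 1) (by lia)).app Y
  have heff : IsEffaced (torsionQuotient D d) (Y⟦(1 : ℤ)⟧) :=
    isEffaced_of_bounded (torsionQuotient_map_eq_zero D d) (a - d)
      (isStrictlyGE_torsionQuotient D d a fun i hi => ha i (Or.inl hi)) _ (b - 1) (c - 1)
      (fun i hi => (hY (i + 1) (by lia)).of_iso (e i))
      (fun i => have := hfin (i + 1); finite_of_iso (e i).symm)
  have hT := triangleOfSES_distinguished (torsionShortComplex_shortExact D d n)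
  -- Since `f` dies in `Γ_𝔪 D`, its shift factors through the connecting map from the quotient
  -- complex. The factor `g` dies at a later stage `m`, and connecting maps commute with the
  -- transition maps.
  obtain ⟨g, hg⟩ := Triangle.coyoneda_exact₁ _ hT (f⟦(1 : ℤ)⟧') (by
    refine ((CategoryTheory.shiftFunctor (DerivedCategory (ModuleCat.{u} R)) (1 : ℤ)).map_comp _ _).symm.trans ?_
    exact (congrArg _ hf).trans (Functor.map_zero _ _ _))
  obtain ⟨m, h, hm⟩ := heff n g
  refine ⟨m, leOfHom h, ?_⟩
  apply (CategoryTheory.shiftFunctor (DerivedCategory (ModuleCat.{u} R)) (1 : ℤ)).map_injective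
  rw [Functor.map_comp, Functor.map_zero]
  refine (congrArg (· ≫ _) hg).trans ((Category.assoc _ _ _).trans ?_)
  have hcomm := (triangleOfSES.map (torsionShortComplex_shortExact D d n)
    (torsionShortComplex_shortExact D d m) (torsionShortComplexMap D d h)).comm₃
  refine (congrArg (g ≫ ·) hcomm).trans ?_
  refine (Category.assoc _ _ _).symm.trans ?_
  exact (congrArg (· ≫ _) hm).trans zero_comp

end TorsionQuotient

/-! ### `Ext` classes as maps in the derived category. -/

section ExtHom

open DerivedCategory

universe v v' w

variable {C : Type v} [Category.{v'} C] [Abelian C] [HasExt.{w} C] [HasDerivedCategory C]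
  {L M N : C} {n : ℕ}

/-- A class in `Ext^n(L, N)`, viewed as a map from `L` in degree `n` to `N` in degree `0`. -/
def extHom (α : Ext L N n) : (singleFunctor C n).obj L ⟶ (singleFunctor C 0).obj N :=
  (CategoryTheory.shiftFunctor (DerivedCategory C) (n : ℤ)).preimage
    (((singleFunctors C).shiftIso (n : ℤ) 0 n (add_zero _)).hom.app L ≫ α.hom)

lemma shiftFunctor_map_extHom (α : Ext L N n) :
    (CategoryTheory.shiftFunctor (DerivedCategory C) (n : ℤ)).map (extHom α) =
      ((singleFunctors C).shiftIso (n : ℤ) 0 n (add_zero _)).hom.app L ≫ α.hom :=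
  Functor.map_preimage _ _

lemma extHom_mk₀_comp (g : L ⟶ M) (α : Ext M N n) :
    extHom ((Ext.mk₀ g).comp α (zero_add n)) = (singleFunctor C n).map g ≫ extHom α := by
  apply (CategoryTheory.shiftFunctor (DerivedCategory C) (n : ℤ)).map_injective
  rw [Functor.map_comp, shiftFunctor_map_extHom, shiftFunctor_map_extHom, Ext.comp_hom,
    Ext.mk₀_hom, ShiftedHom.mk₀_comp]
  exact (((singleFunctors C).shiftIso (n : ℤ) 0 n (add_zero _)).hom.naturality_assoc g _).symm

lemma extHom_comp_mk₀ (α : Ext L M n) (g : M ⟶ N) :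
    extHom (α.comp (Ext.mk₀ g) (add_zero n)) = extHom α ≫ (singleFunctor C 0).map g := by
  apply (CategoryTheory.shiftFunctor (DerivedCategory C) (n : ℤ)).map_injective
  rw [Functor.map_comp, shiftFunctor_map_extHom, shiftFunctor_map_extHom, Ext.comp_hom,
    Ext.mk₀_hom, ShiftedHom.comp_mk₀, Category.assoc]

lemma extHom_eq_zero_iff (α : Ext L N n) : extHom α = 0 ↔ α = 0 := by
  rw [← (CategoryTheory.shiftFunctor (DerivedCategory C) (n : ℤ)).map_eq_zero_iff,
    shiftFunctor_map_extHom, Ext.ext_iff, Ext.zero_hom]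
  exact ⟨fun h => (cancel_epi _).1 (h.trans comp_zero.symm), fun h => by rw [h]; exact comp_zero⟩

end ExtHom

/-! ### Duals of derived maps, in terms of the complexes `dual D X`. -/

section DualHom

open DerivedCategory

universe w

variable {R : Type u} [CommRing R] [HasDerivedCategory.{w} (ModuleCat.{u} R)]
  (D : CochainComplex (ModuleCat.{u} R) ℤ) [D.IsKInjective]
  {X Y Z : CochainComplex (ModuleCat.{u} R) ℤ}

/-- The map `Hom_R(Y, D) ⟶ Hom_R(X, D)` in the derived category induced by `α : X ⟶ Y`. -/
def dualHom (α : Q.obj X ⟶ Q.obj Y) : Q.obj (dual D Y) ⟶ Q.obj (dual D X) :=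
  (derivedDualIso D Y).inv ≫ (derivedDual D).map α.op ≫ (derivedDualIso D X).hom

lemma dualHom_comp (α : Q.obj X ⟶ Q.obj Y) (β : Q.obj Y ⟶ Q.obj Z) :
    dualHom D (α ≫ β) = dualHom D β ≫ dualHom D α := by
  simp [dualHom]

lemma dualHom_Q_map (f : X ⟶ Y) : dualHom D (Q.map f) = Q.map (dualMap D f) := by
  rw [dualHom, derivedDualIso_naturality, Iso.inv_hom_id_assoc]

lemma dualHom_zero : dualHom D (0 : Q.obj X ⟶ Q.obj Y) = 0 := by
  rw [← Q.map_zero, dualHom_Q_map, dualMap_zero, Q.map_zero]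

lemma eq_zero_of_dualHom_eq_zero [QuasiIso (evalDual D Y)] (α : Q.obj X ⟶ Q.obj Y)
    (h : dualHom D α = 0) : α = 0 := by
  refine eq_zero_of_derivedDual_map_eq_zero D α ?_
  rw [← cancel_epi (derivedDualIso D Y).inv, ← cancel_mono (derivedDualIso D X).hom,
    Category.assoc, comp_zero, zero_comp]
  exact h

end DualHom

section HomologyVanishing

open DerivedCategory

universe w

variable {R : Type u} [CommRing R] [HasDerivedCategory.{w} (ModuleCat.{u} R)]
  {X : CochainComplex (ModuleCat.{u} R) ℤ}

/-- Vanishing is tested one class at a time, so the map `g` that carries a class may depend on it.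
-/
lemma homologyFunctor_map_eq_zero_of_forall (s : ℤ) {W : DerivedCategory (ModuleCat.{u} R)}
    (f : Q.obj X ⟶ W)
    (h : ∀ x : X.homology s, ∃ (Y : CochainComplex (ModuleCat.{u} R) ℤ) (g : Y ⟶ X)
      (y : Y.homology s), (HomologicalComplex.homologyMap g s).hom y = x ∧ Q.map g ≫ f = 0) :
    (homologyFunctor (ModuleCat.{u} R) s).map f = 0 := by
  refine (cancel_epi ((homologyFunctorFactors _ s).inv.app X)).1 ?_
  rw [comp_zero]
  ext x
  obtain ⟨Y, g, y, rfl, hg⟩ := h x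
  have h₁ := (homologyFunctorFactors (ModuleCat.{u} R) s).inv.naturality g
  have h₂ : HomologicalComplex.homologyMap g s ≫ (homologyFunctorFactors _ s).inv.app X ≫
      (homologyFunctor (ModuleCat.{u} R) s).map f = 0 := by
    refine (Category.assoc _ _ _).symm.trans ((congrArg (· ≫ _) h₁).trans ?_)
    rw [Category.assoc]
    refine (congrArg _ ((Functor.map_comp _ _ _).symm.trans (congrArg _ hg))).trans ?_
    rw [Functor.map_zero]
    exact comp_zero
  exact congrArg (fun g => g.hom y) h₂

lemma isZero_homologyFunctor_obj (s : ℤ) (h : IsZero (X.X s)) :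
    IsZero ((homologyFunctor (ModuleCat.{u} R) s).obj (Q.obj X)) :=
  ((HomologicalComplex.exactAt_iff_isZero_homology _ _).1 (exactAt_of_isZero_X h)).of_iso
    ((homologyFunctorFactors _ s).app X)

end HomologyVanishing

/-! ### `H^0(Hom_R(M, D))` in terms of maps from `M` to the canonical module. -/

section CanonicalModule

open CochainComplex CochainComplex.HomComplex

variable {R : Type u} [CommRing R] (D : CochainComplex (ModuleCat.{u} R) ℤ)

lemma dualMap_fromSingleMk {M N : ModuleCat.{u} R} (g : M ⟶ N) {p q n : ℤ} (h : p + n = q)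
    (f : N ⟶ D.X q) :
    ((dualMap D ((CochainComplex.singleFunctor (ModuleCat.{u} R) p).map g)).f n).hom
      (Cochain.fromSingleMk f h) = Cochain.fromSingleMk (g ≫ f) h := by
  refine (Cochain.fromSingleEquiv h).injective ?_
  rw [Cochain.fromSingleEquiv_fromSingleMk]
  ext x
  change (Cochain.v (((dualMap D ((CochainComplex.singleFunctor (ModuleCat.{u} R) p).map g)).f
    n).hom (Cochain.fromSingleMk f h) : Cochain (sg p M) D n) p q h).hom (sgElt p x) =
      f.hom (g.hom x)
  rw [dualMap_v]
  change ((Cochain.fromSingleMk f h).v p q h).hom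
    ((((CochainComplex.singleFunctor (ModuleCat.{u} R) p).map g).f p).hom (sgElt p x)) = _
  rw [sg_map_sgElt, Cochain.fromSingleMk_v]
  have := congrArg (fun e => e.hom (g.hom x))
    (HomologicalComplex.singleObjXSelf (.up ℤ) p N).inv_hom_id
  exact congrArg f.hom this

/-- If `D` is zero in degree `-1`, a cocycle of degree `0` of `Hom_R(M, D)` factors through
`H^0(D)`. -/
lemma exists_homologyMap_dualMap_eq (hD : IsZero (D.X (-1))) (M : ModuleCat.{u} R)
    (x : (dual D (sg 0 M)).homology 0) :
    ∃ (g : M ⟶ D.homology 0) (y : (dual D (sg 0 (D.homology 0))).homology 0),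
      (HomologicalComplex.homologyMap (dualMap D
        ((CochainComplex.singleFunctor (ModuleCat.{u} R) 0).map g)) 0).hom y = x := by
  obtain ⟨c, rfl⟩ := homologyπ_surjective _ _ x
  obtain ⟨f, hf⟩ : ∃ f : M ⟶ D.X 0,
      (Cochain.fromSingleMk f (zero_add 0) : Cochain (sg 0 M) D 0) =
        ((dual D (sg 0 M)).iCycles 0).hom c :=
    (Cochain.fromSingleEquiv (zero_add (0 : ℤ))).symm.surjective _
  have hd : f ≫ D.d 0 1 = 0 := by
    apply (Cochain.fromSingleEquiv (zero_add (1 : ℤ))).symm.injective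
    rw [map_zero]
    refine (Cochain.δ_fromSingleMk f (zero_add 0) 1 1 (zero_add 1)).symm.trans ?_
    rw [hf]
    exact d_iCycles 0 1 c
  -- As `D^(-1) = 0`, the module `H^0(D)` is the kernel of `D^0 ⟶ D^1`. The cocycle `f` corestricts
  -- to `g`, and `ψ` is the inclusion of `H^0(D)` in `D^0`.
  have hπ : IsIso (D.homologyπ 0) := D.isIso_homologyπ (-1) 0 (by simp) (hD.eq_of_src _ _)
  let g : M ⟶ D.homology 0 := D.liftCycles f 1 (by simp) hd ≫ D.homologyπ 0
  let ψ : Cochain (sg 0 (D.homology 0)) D 0 :=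
    Cochain.fromSingleMk (inv (D.homologyπ 0) ≫ D.iCycles 0) (zero_add 0)
  have hψ : δ 0 1 ψ = 0 := by
    dsimp only [ψ]
    rw [Cochain.δ_fromSingleMk _ _ 1 1 (zero_add 1), Category.assoc, D.iCycles_d, comp_zero,
      Cochain.fromSingleMk_zero]
  obtain ⟨c', hc'⟩ := exists_cycles (K := dual D (sg 0 (D.homology 0))) 0 1 (by lia) ψ hψ
  refine ⟨g, ((dual D (sg 0 (D.homology 0))).homologyπ 0).hom c', ?_⟩
  rw [homologyMap_homologyπ]
  congr 1
  apply iCycles_injective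
  rw [iCycles_cyclesMap, hc', ← hf]
  have hg : g ≫ inv (D.homologyπ 0) ≫ D.iCycles 0 = f := by simp [g]
  refine (dualMap_fromSingleMk D g (zero_add 0) _).trans ?_
  exact congrArg (fun a => (Cochain.fromSingleMk a (zero_add 0) : Cochain (sg 0 M) D 0)) hg

end CanonicalModule

/-! ### From vanishing on `ω_R` to vanishing on all finitely generated modules. -/

section Main

open DerivedCategory CochainComplex IsLocalRing

universe w

variable {R : Type u} [CommRing R] [IsLocalRing R]
  {D : CochainComplex (ModuleCat.{u} R) ℤ} {d : ℕ}

section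

variable [HasDerivedCategory.{w} (ModuleCat.{u} R)]

/-- The restriction of `α ∈ Ext^d_R(k, N)` to `Ext^d_R(R/𝔪^(n+1), N)`, viewed as a map in the
derived category. -/
def extRestriction {N : ModuleCat.{u} R} (α : Ext (resField R) N d) (n : ℕ) :
    Q.obj (sg d (quotPow R n)) ⟶ Q.obj (sg 0 N) :=
  extHom ((Ext.mk₀ (quotPowToResField R n)).comp α (zero_add d))

lemma Q_map_comp_extRestriction {N : ModuleCat.{u} R} (α : Ext (resField R) N d)
    {n m : ℕ} (h : n ≤ m) :
    Q.map ((CochainComplex.singleFunctor (ModuleCat.{u} R) d).map (quotPowMap R h)) ≫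
      extRestriction α n = extRestriction α m := by
  rw [extRestriction, extRestriction, ← quotPowMap_comp_quotPowToResField h,
    ← Ext.mk₀_comp_mk₀_assoc]
  exact (extHom_mk₀_comp (quotPowMap R h) _).symm

lemma extRestriction_comp_Q_map {M N : ModuleCat.{u} R} (α : Ext (resField R) M d) (g : M ⟶ N)
    (n : ℕ) :
    extRestriction α n ≫ Q.map ((CochainComplex.singleFunctor (ModuleCat.{u} R) 0).map g) =
      extRestriction (α.comp (Ext.mk₀ g) (add_zero d)) n := by
  rw [extRestriction, extRestriction, ← Ext.comp_assoc_of_third_deg_zero]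
  exact (extHom_comp_mk₀ _ g).symm

lemma extRestriction_eq_zero_iff {N : ModuleCat.{u} R} (α : Ext (resField R) N d) (n : ℕ) :
    extRestriction α n = 0 ↔
      (Ext.mk₀ (quotPowToResField R n)).comp α (zero_add d) = 0 :=
  extHom_eq_zero_iff _

variable [D.IsKInjective]

/-- The map `Hom_R(N, D) ⟶ Hom_R(R/𝔪^(n+1), D)` dual to the restriction of
`α ∈ Ext^d_R(k, N)` to `Ext^d_R(R/𝔪^(n+1), N)`. -/
def dualRestriction (D : CochainComplex (ModuleCat.{u} R) ℤ) [D.IsKInjective]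
    {N : ModuleCat.{u} R} (α : Ext (resField R) N d) (n : ℕ) :
    Q.obj (dual D (sg 0 N)) ⟶ Q.obj (dualQuotPow D d n) :=
  dualHom D (extRestriction α n)

lemma dualRestriction_comp_dualQuotPowMap {N : ModuleCat.{u} R} (α : Ext (resField R) N d)
    {n m : ℕ} (h : n ≤ m) :
    dualRestriction D α n ≫ Q.map (dualQuotPowMap D d h) = dualRestriction D α m := by
  rw [dualRestriction, dualRestriction, dualQuotPowMap, ← dualHom_Q_map, ← dualHom_comp,
    Q_map_comp_extRestriction]

/-- The composite into `Γ_𝔪 D` does not depend on `n`, so it is zero as soon as one restriction of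
`α` is zero. -/
lemma dualRestriction_comp_toTorsion {N : ModuleCat.{u} R} (α : Ext (resField R) N d) (n : ℕ) :
    dualRestriction D α n ≫ Q.map (dualQuotPowToTorsion D d n) =
      dualRestriction D α 0 ≫ Q.map (dualQuotPowToTorsion D d 0) := by
  rw [← dualRestriction_comp_dualQuotPowMap α n.zero_le, Category.assoc, ← Q.map_comp,
    dualQuotPowMap_toTorsion]

lemma dualRestriction_naturality {M N : ModuleCat.{u} R} (α : Ext (resField R) M d) (g : M ⟶ N)
    (n : ℕ) :
    Q.map (dualMap D ((CochainComplex.singleFunctor (ModuleCat.{u} R) 0).map g)) ≫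
      dualRestriction D α n = dualRestriction D (α.comp (Ext.mk₀ g) (add_zero d)) n := by
  rw [dualRestriction, dualRestriction, ← dualHom_Q_map, ← dualHom_comp,
    extRestriction_comp_Q_map]

lemma dualRestriction_eq_zero {N : ModuleCat.{u} R} (α : Ext (resField R) N d) (n : ℕ)
    (h : (Ext.mk₀ (quotPowToResField R n)).comp α (zero_add d) = 0) :
    dualRestriction D α n = 0 := by
  rw [dualRestriction, (extRestriction_eq_zero_iff _ _).2 h, dualHom_zero]

end

/-- If `ζ^d` vanishes on the canonical module, then it vanishes on finitely generated modules. -/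
theorem zeta_eq_zero_of_canonicalModule [IsNoetherianRing R]
    (hD : IsNormalizedDualizingComplex d D) (hω : zeta (canonicalModule D) d = 0)
    (N : ModuleCat.{u} R) [Module.Finite R N] : zeta N d = 0 := by
  let := HasDerivedCategory.standard (ModuleCat.{u} R)
  have := hD.isKInjective
  ext α
  rw [LinearMap.zero_apply, zeta_eq_zero_iff]
  have hvan : dualRestriction D α 0 ≫ Q.map (dualQuotPowToTorsion D d 0) = 0 := by
    obtain ⟨s, hs, hs'⟩ := exists_torsionComplex_homology d hD.toIsDualizingComplex
    refine eq_zero_of_homologyFunctor_map_eq_zero _ _ s hs hs' _ ?_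
    -- The bounds on `D` settle `s ≠ 0`: for `s < 0` the complex `Hom(N, D)` is zero in degree `s`,
    -- and for `s > 0` the term `Γ_𝔪 (D^(d+s))` is zero.
    rcases lt_trichotomy s 0 with h | rfl | h
    · refine (isZero_homologyFunctor_obj s ?_).eq_of_src _ _
      exact isZero_dual_sg_X D 0 s N (hD.range _ (by lia))
    · refine homologyFunctor_map_eq_zero_of_forall 0 _ fun x => ?_
      obtain ⟨g, y, hy⟩ := exists_homologyMap_dualMap_eq D (hD.range _ (by lia)) N x
      refine ⟨_, _, y, hy, ?_⟩
      -- The class `x` is pulled back along `g : N ⟶ ω`, and moving `g` across the duality replaces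
      -- `α` by `g_* α`. A restriction of `g_* α` vanishes because `ζ_ω = 0`; its index `n` depends
      -- on `x`, which is harmless as the composite does not depend on `n`.
      have hg : zeta (canonicalModule D) d (α.comp (Ext.mk₀ g) (add_zero d)) = 0 := by
        rw [hω, LinearMap.zero_apply]
      obtain ⟨n, hn⟩ := (zeta_eq_zero_iff _ _ _).1 hg
      rw [← dualRestriction_comp_toTorsion α n, ← Category.assoc, dualRestriction_naturality,
        dualRestriction_eq_zero _ _ hn, zero_comp]
    · refine (isZero_homologyFunctor_obj s ?_).eq_of_tgt _ _
      exact IsZero.of_mono (torsionι D d s) (hD.range _ (by lia))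
  -- Vanishing in the union becomes vanishing at a finite stage `m`, and biduality for `N` turns it
  -- into vanishing of the restriction of `α` to `R/𝔪^(m+1)`.
  obtain ⟨m, h, hm⟩ := exists_comp_dualQuotPowMap_eq_zero d hD.toIsDualizingComplex
    (Q.obj (dual D (sg 0 N))) 0 d (fun i hi => isZero_homologyFunctor_obj i
      (isZero_dual_sg_X D 0 i N (hD.range _ (by lia))))
    (fun i => @finite_of_iso _ _ _ _ ((homologyFunctorFactors _ i).app _).symm
      (finite_homology_dual_sg hD.toIsDualizingComplex i N)) 0 _ hvan
  rw [dualRestriction_comp_dualQuotPowMap] at hm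
  have := quasiIso_evalDual_sg hD.toIsDualizingComplex N
  exact ⟨m, (extRestriction_eq_zero_iff _ _).1 (eq_zero_of_dualHom_eq_zero D _ hm)⟩

end Main
end LocalCoh
end

theorem mainTheorem10 {R : Type u} [CommRing R] [IsNoetherianRing R] [IsLocalRing R]
    (d : ℕ) (hd : ringKrullDim R = d)
    (F : ProjectiveResolution (LocalCoh.resField R)) (hF : LocalCoh.IsMinimalFree F) :
    (LocalCoh.zeta (LocalCoh.syzygy F d) d (LocalCoh.canonicalClass F d) = 0 ↔
      LocalCoh.zeta (LocalCoh.syzygy F d) d = 0) ∧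
    (LocalCoh.zeta (LocalCoh.syzygy F d) d = 0 ↔
      ∀ N : ModuleCat.{u} R, LocalCoh.zeta N d = 0) ∧
    (∀ D : CochainComplex (ModuleCat.{u} R) ℤ, LocalCoh.IsNormalizedDualizingComplex d D →
      (LocalCoh.zeta (LocalCoh.syzygy F d) d ≠ 0 ↔
        LocalCoh.zeta (LocalCoh.canonicalModule D) d ≠ 0)) := by
  have h₁ (h : LocalCoh.zeta (LocalCoh.syzygy F d) d (LocalCoh.canonicalClass F d) = 0) :
      ∀ N : ModuleCat.{u} R, LocalCoh.zeta N d = 0 :=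
    LocalCoh.zeta_eq_zero_of_canonicalClass F d h
  have h₂ (h : LocalCoh.zeta (LocalCoh.syzygy F d) d = 0) :
      LocalCoh.zeta (LocalCoh.syzygy F d) d (LocalCoh.canonicalClass F d) = 0 := by
    rw [h, LinearMap.zero_apply]
  refine ⟨⟨fun h => h₁ h _, h₂⟩, ⟨fun h => h₁ (h₂ h), fun h => h _⟩, fun D hD => not_congr ?_⟩
  have := hF.finite d
  have : Module.Finite R (LocalCoh.syzygy F d) :=
    Module.Finite.of_surjective (cokernel.π (F.complex.d (d + 1) d)).hom
      ((ModuleCat.epi_iff_surjective _).1 inferInstance)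
  exact ⟨fun h => h₁ (h₂ h) _, fun h => LocalCoh.zeta_eq_zero_of_canonicalModule hD h _⟩
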